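/- Conventions. $\mathbb N^*=\{1,2,\dots\}$, $\log$ is the logarithm to base $2$, $\ln$ the natural logarithm, $\log^{(2)}=\log\circ\log$, $\log^{a}(x)=(\log x)^a$, and $1/\infty=0$. Let $p,q\in[1,\infty]$. The ratio $p/(pb+1)$ is understood as $1/b$ for $p=\infty$, and $p^{1/p}$ as $1$ for $p=\infty$. For a sequence $\{\mu_n\}_{n\in\mathbb N^*}$ of positive real numbers, the $p$-ellipsoid with semi-axes $\{\mu_n\}$ is $$\mathcal E_p=\Big\{x\in\ell^p(\mathbb N^*;\mathbb R)\ :\ \Big(\sum_{n\ge 1}|x_n/\mu_n|^p\Big)^{1/p}\le 1\Big\},$$ with $\sup_n|x_n/\mu_n|\le 1$ in place of the sum condition if $p=\infty$. For $\varepsilon>0$, $N(\varepsilon;\mathcal E_p,\|\cdot\|_q)\in\mathbb N^*\cup\{\infty\}$ is the smallest number of closed $\|\cdot\|_q$-balls of radius $\varepsilon$ with centers in $\ell^q(\mathbb N^*;\mathbb R)$ that cover $\mathcal E_p$ (in (i), where $\mathcal E_p$ need not be contained in $\ell^q$, the set $\mathcal E_p$ is replaced by $\mathcal E_p\cap\ell^q$),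 and $H(\varepsilon;\mathcal E_p,\|\cdot\|_q)=\log N(\varepsilon;\mathcal E_p,\|\cdot\|_q)$ is the metric entropy. With $\Gamma(\cdot)$ the Euler function, put $$\Gamma_{p,q}=\frac{\Gamma(1/p+1)\,p^{1/p}}{\Gamma(1/q+1)\,q^{1/q}\,e^{1/q-1/p}},\qquad b^*=b+\frac1p-\frac1q,\qquad \gamma_{p,q,b}=\Big(\frac{b}{b+\frac1p-\frac1q}\Big)^{\frac1q-\frac1p}.$$ **Statement.** Let $p,q\in[1,\infty]$, $b>0$, $c>0$, and let $\{\mu_n\}_{n\in\mathbb N^*}$ be a non-increasing sequence of positive real numbers with $\mu_n=\frac{c}{n^b}+o_{n\to\infty}\big(\frac1{n^b}\big)$. Let $\mathcal E_p$ be the $p$-ellipsoid with semi-axes $\{\mu_n\}_{n\in\mathbb N^*}$. (i) If $q\le p/(pb+1)$, then $\mathcal E_p$ (more precisely $\mathcal E_p\cap\ell^q$) is not compact in $\ell^q$, and there exists $\varepsilon^*>0$ such that $H(\varepsilon;\mathcal E_p,\|\cdot\|_q)=\infty$ for all $\varepsilon\in(0,\varepsilon^*)$. (ii) If $p/(pb+1)<q\le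 p$, then $\mathcal E_p\subset\ell^q$ and $$\frac{b}{\ln 2}\Big(\frac{\Gamma_{p,q}\,c}{\varepsilon}\Big)^{1/b^*}+o_{\varepsilon\to0}\big(\varepsilon^{-1/b^*}\big)\ \le\ H(\varepsilon;\mathcal E_p,\|\cdot\|_q)\ \le\ \Big(\frac{b}{\ln 2}+1\Big)\Big(\frac{\gamma_{p,q,b}\,c}{\varepsilon}\Big)^{1/b^*}+o_{\varepsilon\to0}\big(\varepsilon^{-1/b^*}\big).$$ (iii) If $p<q$, then $\mathcal E_p\subset\ell^q$, $$\frac{b}{\ln 2}\Big(\frac{\Gamma_{p,q}\,c}{\varepsilon}\Big)^{1/b^*}+o_{\varepsilon\to0}\big(\varepsilon^{-1/b^*}\big)\ \le\ H(\varepsilon;\mathcal E_p,\|\cdot\|_q),$$ and $$H(\varepsilon;\mathcal E_p,\|\cdot\|_q)=\begin{cases}O_{\varepsilon\to0}\big(\varepsilon^{-1/b^*}\,\log^{(2)}(\varepsilon^{-1})\big),&\text{if } b\ge1,\\ O_{\varepsilon\to0}\big(\varepsilon^{-1/b^*}\,\log^{1-b}(\varepsilon^{-1})\big),&\text{if } b<1.\end{cases}$$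 -/

import Mathlib

open Filter Topology Asymptotics
open scoped ENNReal NNReal

noncomputable section

namespace EllipsoidEntropy

/-- The ellipsoid norm of a real sequence `x` with semi-axes `μ`, with values in `[0, ∞]`:
`(∑ |x n / μ n| ^ p) ^ (1 / p)` for finite `p`, and `sup |x n / μ n|` for `p = ∞`. -/
def ellipsoidNorm (p : ℝ≥0∞) (μ x : ℕ+ → ℝ) : ℝ≥0∞ :=
  if p = ∞ then ⨆ n, ENNReal.ofReal |x n / μ n|
  else (∑' n, ENNReal.ofReal |x n / μ n| ^ p.toReal) ^ (1 / p.toReal)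

/-- The `p`-ellipsoid with semi-axes `μ`: all `x ∈ ℓ^p` of ellipsoid norm at most `1`. -/
def ellipsoid (p : ℝ≥0∞) (μ : ℕ+ → ℝ) : Set (ℕ+ → ℝ) :=
  {x | Memℓp x p ∧ ellipsoidNorm p μ x ≤ 1}

/-- The elements of the `p`-ellipsoid that lie in `ℓ^q`, as a subset of the normed space `ℓ^q`. -/
def ellipsoidIn (p q : ℝ≥0∞) (μ : ℕ+ → ℝ) : Set (lp (fun _ : ℕ+ => ℝ) q) :=
  {x | (x : ℕ+ → ℝ) ∈ ellipsoid p μ}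

/-- The metric entropy of a subset `A` of a metric space `X`: the base-2 logarithm of the smallest
number of closed balls of radius `ε` with centers in `X` that cover `A`; it is `⊤` if no finite
number of balls suffices. -/
def metricEntropy {X : Type*} [PseudoEMetricSpace X] (ε : ℝ) (A : Set X) : EReal :=
  ENNReal.log ((Metric.externalCoveringNumber ε.toNNReal A : ℕ∞) : ℝ≥0∞) / (Real.log 2 : EReal)

/-- The real number `1 / p`, equal to `0` for `p = ∞`. -/
def recip (p : ℝ≥0∞) : ℝ := (p⁻¹).toReal

/-- The threshold `p / (p b + 1)`, read as `1 / b` for `p = ∞`. -/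
def threshold (p : ℝ≥0∞) (b : ℝ) : ℝ≥0∞ :=
  if p = ∞ then ENNReal.ofReal (1 / b) else ENNReal.ofReal (p.toReal / (p.toReal * b + 1))

/-- The number `p ^ (1 / p)`, read as its limit `1` for `p = ∞`. -/
def selfRoot (p : ℝ≥0∞) : ℝ :=
  if p = ∞ then 1 else p.toReal ^ (1 / p.toReal)

/-- The constant
`Γ_{p,q} = Γ(1/p + 1) p ^ (1/p) / (Γ(1/q + 1) q ^ (1/q) e ^ (1/q - 1/p))`. -/
def GammaConst (p q : ℝ≥0∞) : ℝ :=
  Real.Gamma (recip p + 1) * selfRoot p /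
    (Real.Gamma (recip q + 1) * selfRoot q * Real.exp (recip q - recip p))

/-- The exponent `b* = b + 1/p - 1/q`. -/
def bStar (p q : ℝ≥0∞) (b : ℝ) : ℝ := b + recip p - recip q

/-- The constant `γ_{p,q,b} = (b / (b + 1/p - 1/q)) ^ (1/q - 1/p)`. -/
def gammaConst (p q : ℝ≥0∞) (b : ℝ) : ℝ :=
  (b / bStar p q b) ^ (recip q - recip p)

end EllipsoidEntropy

end

/-!
The lower bounds compare volumes. A covering of the ellipsoid by `ℓ^q` balls of radius `ε` restricts
to a covering of its section by the first `d` coordinates, so the number of balls is at least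
`(∏ i ≤ d, μ i) * vol B_p / (ε ^ d * vol B_q)`. Stirling's formula turns the ratio of the volumes of
the unit balls into `Γ_{p,q}`, and `d ≈ (Γ_{p,q} c / ε) ^ (1 / b*)` is the optimal dimension. If
`b* ≤ 0` the bound is unbounded in `d`, so that no finite covering exists.

For `q ≤ p`, divide the first `d` coordinates by `μ i / μ (d + 1)`. By Hölder's inequality with
`1 / r = 1 / q - 1 / p`, this maps the ellipsoid into the `ℓ^q` ball whose radius is the `ℓ^r` norm
of the capped sequence `min (μ n) (μ (d + 1))`, which is asymptotic to `γ_{p,q,b} c d ^ (-b*)`. It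
remains to cover a `d`-dimensional `ℓ^q` ball, stretched by factors `μ i / μ (d + 1) ≥ 1`, by unit
balls; a greedy covering argument in the style of Rogers achieves this with essentially
`2 ^ d * ∏ i ≤ d, μ i / μ (d + 1)` balls, and the logarithm of the product is `b d + o(d)`.

For `p < q`, round each coordinate towards zero to a multiple of a step depending on its semi-axis.
The steps are chosen so that the rounded points solve `∑ w n * |k n| ≤ 1` with integers `k n` and
explicit weights `w n`; Chernoff's method bounds the number of such lattice points.
-/

namespace EllipsoidEntropy

open MeasureTheory

/-! ### The `ℓ^q` norm -/

section SeqNorm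

variable {ι κ : Type*} {q : ℝ≥0∞} {f g : ι → ℝ}

/-- The `ℓ^q` norm of a family of real numbers, with values in `[0, ∞]`. Having it on every family
makes membership in `ℓ^q` and Hölder's inequality statements without side conditions. -/
noncomputable def seqNorm (q : ℝ≥0∞) (f : ι → ℝ) : ℝ≥0∞ :=
  if q = ∞ then ⨆ n, ‖f n‖ₑ else (∑' n, ‖f n‖ₑ ^ q.toReal) ^ (1 / q.toReal)

lemma seqNorm_top (f : ι → ℝ) : seqNorm ∞ f = ⨆ n, ‖f n‖ₑ := if_pos rfl

lemma seqNorm_of_ne_top (hq : q ≠ ∞) (f : ι → ℝ) :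
    seqNorm q f = (∑' n, ‖f n‖ₑ ^ q.toReal) ^ (1 / q.toReal) := if_neg hq

lemma toReal_pos_of_one_le (hq1 : 1 ≤ q) (hq : q ≠ ∞) : 0 < q.toReal :=
  ENNReal.toReal_pos (zero_lt_one.trans_le hq1).ne' hq

lemma seqNorm_rpow_toReal (hq1 : 1 ≤ q) (hq : q ≠ ∞) (f : ι → ℝ) :
    seqNorm q f ^ q.toReal = ∑' n, ‖f n‖ₑ ^ q.toReal := by
  rw [seqNorm_of_ne_top hq, ← ENNReal.rpow_mul,
    one_div_mul_cancel (toReal_pos_of_one_le hq1 hq).ne', ENNReal.rpow_one]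

lemma seqNorm_le_iff (hq1 : 1 ≤ q) (hq : q ≠ ∞) {C : ℝ≥0∞} :
    seqNorm q f ≤ C ↔ ∑' n, ‖f n‖ₑ ^ q.toReal ≤ C ^ q.toReal := by
  rw [← seqNorm_rpow_toReal hq1 hq, ENNReal.rpow_le_rpow_iff (toReal_pos_of_one_le hq1 hq)]

lemma seqNorm_mono (h : ∀ n, |f n| ≤ |g n|) : seqNorm q f ≤ seqNorm q g := by
  have enorm_le n : ‖f n‖ₑ ≤ ‖g n‖ₑ := enorm_le_iff_norm_le.2 (h n)
  unfold seqNorm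
  split_ifs
  · exact iSup_mono enorm_le
  · gcongr with n
    exact enorm_le n

lemma seqNorm_eq_eLpNorm (hq : 1 ≤ q) (f : ι → ℝ) :
    seqNorm q f = eLpNorm f q (@Measure.count ι ⊤) := by
  let _ : MeasurableSpace ι := ⊤
  rcases eq_or_ne q ∞ with rfl | htop
  · rw [seqNorm_top, eLpNorm_exponent_top, eLpNormEssSup_count]
  · rw [seqNorm_of_ne_top htop,
      eLpNorm_eq_lintegral_rpow_enorm_toReal (zero_lt_one.trans_le hq).ne' htop, lintegral_count]

lemma seqNorm_mul_le {p r : ℝ≥0∞} (hp : 1 ≤ p) (hq : 1 ≤ q) (hr : 1 ≤ r)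
    (h : p⁻¹ + r⁻¹ = q⁻¹) (f g : ι → ℝ) :
    seqNorm q (fun n => f n * g n) ≤ seqNorm p f * seqNorm r g := by
  let _ : MeasurableSpace ι := ⊤
  have : DiscreteMeasurableSpace ι := ⟨fun _ => trivial⟩
  have : ENNReal.HolderTriple p r q := ⟨h⟩
  rw [seqNorm_eq_eLpNorm hp, seqNorm_eq_eLpNorm hq, seqNorm_eq_eLpNorm hr]
  exact eLpNorm_smul_le_mul_eLpNorm (E := ℝ) (𝕜 := ℝ)
    (Measurable.of_discrete.aestronglyMeasurable) (Measurable.of_discrete.aestronglyMeasurable)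

lemma seqNorm_const_mul (hq : 1 ≤ q) (a : ℝ) (f : ι → ℝ) :
    seqNorm q (fun n => a * f n) = ‖a‖ₑ * seqNorm q f := by
  simp only [seqNorm_eq_eLpNorm hq]
  exact eLpNorm_const_smul a f q _

lemma enorm_le_seqNorm (hq : 1 ≤ q) (f : ι → ℝ) (n : ι) : ‖f n‖ₑ ≤ seqNorm q f := by
  let _ : MeasurableSpace ι := ⊤
  have : DiscreteMeasurableSpace ι := ⟨fun _ => trivial⟩
  rw [seqNorm_eq_eLpNorm hq]
  exact enorm_le_eLpNorm_count f n (zero_lt_one.trans_le hq).ne'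

lemma seqNorm_comp_le {e : κ → ι} (he : Function.Injective e) (f : ι → ℝ) :
    seqNorm q (f ∘ e) ≤ seqNorm q f := by
  rcases eq_or_ne q ∞ with rfl | htop
  · simp only [seqNorm_top]
    exact iSup_le fun k => le_iSup (fun n => ‖f n‖ₑ) (e k)
  · simp only [seqNorm_of_ne_top htop]
    gcongr
    exact ENNReal.tsum_comp_le_tsum_of_injective he (fun n => ‖f n‖ₑ ^ q.toReal)

lemma seqNorm_eq_norm_toLp [Fintype ι] [Fact (1 ≤ q)] (y : ι → ℝ) :
    seqNorm q y = ENNReal.ofReal ‖WithLp.toLp q y‖ := by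
  rcases eq_or_ne q ∞ with rfl | htop
  · simp only [seqNorm_top, ofReal_norm, enorm_eq_nnnorm, PiLp.nnnorm_toLp, Pi.nnnorm_def,
      ENNReal.coe_finset_sup, Finset.sup_univ_eq_iSup]
  · have hq := toReal_pos_of_one_le Fact.out htop
    rw [seqNorm_of_ne_top htop, PiLp.norm_eq_sum hq, tsum_fintype,
      ← ENNReal.ofReal_rpow_of_nonneg (by positivity) (by positivity),
      ENNReal.ofReal_sum_of_nonneg (fun _ _ => by positivity)]
    simp only [← ENNReal.ofReal_rpow_of_nonneg (norm_nonneg _) hq.le, ofReal_norm]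

lemma memℓp_iff_seqNorm_lt_top (hq : 1 ≤ q) : Memℓp f q ↔ seqNorm q f < ∞ := by
  rcases eq_or_ne q ∞ with rfl | htop
  · simp only [memℓp_infty_iff, seqNorm_top, enorm_eq_nnnorm, ENNReal.iSup_coe_lt_top]
    rw [← NNReal.bddAbove_coe, ← Set.range_comp]
    rfl
  · have hq0 := toReal_pos_of_one_le hq htop
    have enorm_rpow n : ‖f n‖ₑ ^ q.toReal = ENNReal.ofReal (‖f n‖ ^ q.toReal) := by
      rw [← ENNReal.ofReal_rpow_of_nonneg (norm_nonneg _) hq0.le, ofReal_norm]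
    rw [memℓp_gen_iff hq0, seqNorm_of_ne_top htop,
      ENNReal.rpow_lt_top_iff_of_pos (by positivity), lt_top_iff_ne_top]
    simp only [enorm_rpow]
    refine ⟨Summable.tsum_ofReal_ne_top, fun h => (ENNReal.summable_toReal h).congr fun n => ?_⟩
    rw [ENNReal.toReal_ofReal (by positivity)]

lemma enorm_lp_eq_seqNorm [Fact (1 ≤ q)] (x : lp (fun _ : ι => ℝ) q) :
    ‖x‖ₑ = seqNorm q (x : ι → ℝ) := by
  rcases eq_or_ne q ∞ with rfl | htop
  · have hfin := (memℓp_iff_seqNorm_lt_top le_top).1 (lp.memℓp x)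
    rw [← ofReal_norm, lp.norm_eq_ciSup, ← ENNReal.ofReal_toReal hfin.ne, seqNorm_top,
      ENNReal.toReal_iSup fun _ => enorm_ne_top]
    simp only [toReal_enorm]
  · have h0 : 0 < q.toReal := toReal_pos_of_one_le Fact.out htop
    rw [seqNorm_of_ne_top htop, ← ofReal_norm, lp.norm_eq_tsum_rpow h0,
      ← ENNReal.ofReal_rpow_of_nonneg (tsum_nonneg fun _ => by positivity) (by positivity),
      ENNReal.ofReal_tsum_of_nonneg (fun _ => by positivity)
        ((memℓp_gen_iff h0).1 (lp.memℓp x))]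
    simp only [← ENNReal.ofReal_rpow_of_nonneg (norm_nonneg _) h0.le, ofReal_norm]

lemma edist_lp_eq_seqNorm [Fact (1 ≤ q)] (x y : lp (fun _ : ι => ℝ) q) :
    edist x y = seqNorm q ((x : ι → ℝ) - (y : ι → ℝ)) := by
  rw [edist_eq_enorm_sub, enorm_lp_eq_seqNorm, lp.coeFn_sub]

section Extend

open Function

variable {e : κ → ι}

lemma seqNorm_top_extend (he : Injective e) (y : κ → ℝ) (x : ι → ℝ) :
    seqNorm ∞ (extend e y x) = max (seqNorm ∞ y) (seqNorm ∞ (extend e 0 x)) := by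
  simp only [seqNorm_top]
  refine le_antisymm (iSup_le fun n => ?_) (max_le (iSup_le fun k => ?_) (iSup_le fun n => ?_))
  · by_cases hn : ∃ k, e k = n
    · obtain ⟨k, rfl⟩ := hn
      rw [he.extend_apply]
      exact le_max_of_le_left (le_iSup (fun k => ‖y k‖ₑ) k)
    · refine le_max_of_le_right (le_of_eq_of_le ?_ (le_iSup _ n))
      simp only [extend_apply' _ _ _ hn]
  · refine le_of_eq_of_le ?_ (le_iSup _ (e k))
    rw [he.extend_apply]
  · by_cases hn : ∃ k, e k = n
    · obtain ⟨k, rfl⟩ := hn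
      simp [he.extend_apply]
    · refine le_of_eq_of_le ?_ (le_iSup _ n)
      simp only [extend_apply' _ _ _ hn]

lemma seqNorm_extend_rpow_toReal (hq1 : 1 ≤ q) (hq : q ≠ ∞) (he : Injective e) (y : κ → ℝ)
    (x : ι → ℝ) : seqNorm q (extend e y x) ^ q.toReal =
      seqNorm q y ^ q.toReal + seqNorm q (extend e 0 x) ^ q.toReal := by
  have hq0 := toReal_pos_of_one_le hq1 hq
  simp only [seqNorm_rpow_toReal hq1 hq]
  rw [← tsum_extend_zero he, ← ENNReal.tsum_add]
  refine tsum_congr fun n => ?_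
  by_cases hn : ∃ k, e k = n
  · obtain ⟨k, rfl⟩ := hn
    simp [he.extend_apply, hq0]
  · simp [extend_apply' _ _ _ hn]

lemma seqNorm_extend_zero (hq : 1 ≤ q) (he : Injective e) (y : κ → ℝ) :
    seqNorm q (extend e y 0) = seqNorm q y := by
  have extend_zero : extend e (0 : κ → ℝ) (0 : ι → ℝ) = 0 := extend_const e 0
  rcases eq_or_ne q ∞ with rfl | htop
  · rw [seqNorm_top_extend he, extend_zero]
    simp [seqNorm_top]
  · have hq0 := toReal_pos_of_one_le hq htop
    rw [← (ENNReal.rpow_left_injective hq0.ne').eq_iff, seqNorm_extend_rpow_toReal hq htop he,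
      extend_zero, seqNorm_rpow_toReal hq htop (0 : ι → ℝ)]
    simp [hq0]

end Extend

end SeqNorm

/-! ### Metric entropy -/

section MetricEntropy

variable {X : Type*} [PseudoEMetricSpace X] {A : Set X} {ε : ℝ}

lemma coe_log_two_pos : (0 : EReal) < (Real.log 2 : ℝ) := by
  exact_mod_cast Real.log_pos one_lt_two

lemma metricEntropy_antitone (A : Set X) : Antitone fun ε : ℝ => metricEntropy ε A :=
  fun _ _ h => EReal.div_le_div_right_of_nonneg coe_log_two_pos.le <| ENNReal.log_le_log <|
    ENat.toENNReal_le.2 <| Metric.externalCoveringNumber_anti <| Real.toNNReal_le_toNNReal h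

lemma metricEntropy_nonneg (hA : A.Nonempty) (ε : ℝ) : 0 ≤ metricEntropy ε A := by
  refine EReal.div_nonneg ?_ coe_log_two_pos.le
  rw [← ENNReal.log_one]
  refine ENNReal.log_le_log ?_
  rw [← ENat.toENNReal_one, ENat.toENNReal_le, Order.one_le_iff_pos]
  exact Metric.externalCoveringNumber_pos_iff.2 hA

lemma metricEntropy_le_of_isCover {C : Set X} {N : ℝ} (hN : 0 < N)
    (hC : Metric.IsCover ε.toNNReal A C) (hfin : C.Finite) (hcard : (C.ncard : ℝ) ≤ N) :
    metricEntropy ε A ≤ ((Real.log N / Real.log 2 : ℝ) : EReal) := by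
  have covering_le :
      ((Metric.externalCoveringNumber ε.toNNReal A : ℕ∞) : ℝ≥0∞) ≤ ENNReal.ofReal N := by
    refine (ENat.toENNReal_le.2 hC.externalCoveringNumber_le_encard).trans ?_
    rw [← hfin.cast_ncard_eq, ENat.toENNReal_coe, ← ENNReal.ofReal_natCast]
    exact ENNReal.ofReal_le_ofReal hcard
  rw [EReal.coe_div, ← ENNReal.log_ofReal_of_pos hN]
  exact EReal.div_le_div_right_of_nonneg coe_log_two_pos.le (ENNReal.log_le_log covering_le)

lemma exists_isCover_encard_eq (ε : ℝ≥0) (A : Set X) :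
    ∃ C : Set X, Metric.IsCover ε A C ∧ C.encard = Metric.externalCoveringNumber ε A := by
  have : Nonempty {C : Set X // Metric.IsCover ε A C} := ⟨A, .refl _ _⟩
  obtain ⟨C, hC⟩ := ENat.exists_eq_iInf
    (fun C : {C : Set X // Metric.IsCover ε A C} => (C : Set X).encard)
  exact ⟨C, C.2, by rw [hC, iInf_subtype]; rfl⟩

lemma le_metricEntropy_of_forall_isCover {N : ℝ} (hN : 0 < N)
    (h : ∀ C : Set X, C.Finite → Metric.IsCover ε.toNNReal A C → N ≤ C.ncard) :
    ((Real.log N / Real.log 2 : ℝ) : EReal) ≤ metricEntropy ε A := by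
  rw [EReal.coe_div, ← ENNReal.log_ofReal_of_pos hN]
  refine EReal.div_le_div_right_of_nonneg coe_log_two_pos.le (ENNReal.log_le_log ?_)
  obtain ⟨C, hC, hcard⟩ := exists_isCover_encard_eq ε.toNNReal A
  rw [← hcard]
  rcases C.finite_or_infinite with hfin | hinf
  · rw [← hfin.cast_ncard_eq, ENat.toENNReal_coe, ← ENNReal.ofReal_natCast]
    exact ENNReal.ofReal_le_ofReal (h C hfin hC)
  · simp [hinf.encard_eq]

lemma metricEntropy_ne_top_of_isCompact (hε : 0 < ε) (hA : IsCompact A) :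
    metricEntropy ε A ≠ ⊤ := by
  obtain ⟨C, -, hfin, hC⟩ := Metric.exists_finite_isCover_of_isCompact
    (Real.toNNReal_pos.2 hε).ne' hA
  refine ne_top_of_le_ne_top (EReal.coe_ne_top _)
    (metricEntropy_le_of_isCover (N := C.ncard + 1) (by positivity) hC hfin (by linarith))

end MetricEntropy

/-! ### Exponents and ellipsoids -/

section Exponents

variable {p q : ℝ≥0∞} {b : ℝ}

lemma recip_eq_inv_toReal (p : ℝ≥0∞) : recip p = p.toReal⁻¹ := ENNReal.toReal_inv p

lemma recip_nonneg (p : ℝ≥0∞) : 0 ≤ recip p := ENNReal.toReal_nonneg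

lemma recip_lt_recip (hp : 1 ≤ p) (h : p < q) : recip q < recip p :=
  ENNReal.toReal_strict_mono (ENNReal.inv_ne_top.2 (zero_lt_one.trans_le hp).ne')
    (ENNReal.inv_lt_inv.2 h)

lemma bStar_pos_of_lt (hp : 1 ≤ p) (hpq : p < q) (hb : 0 < b) : 0 < bStar p q b := by
  have := recip_lt_recip hp hpq
  rw [bStar]
  linarith

lemma exists_holder_exponent (hq : 1 ≤ q) (hqp : q ≤ p) :
    ∃ r : ℝ≥0∞, 1 ≤ r ∧ p⁻¹ + r⁻¹ = q⁻¹ ∧ recip r = recip q - recip p := by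
  have hpq : p⁻¹ ≤ q⁻¹ := ENNReal.inv_le_inv.2 hqp
  have hq1 : q⁻¹ ≤ 1 := ENNReal.inv_le_one.2 hq
  refine ⟨(q⁻¹ - p⁻¹)⁻¹, ?_, ?_, ?_⟩
  · rw [ENNReal.one_le_inv]
    exact tsub_le_self.trans hq1
  · rw [inv_inv, add_tsub_cancel_of_le hpq]
  · rw [recip, inv_inv, ENNReal.toReal_sub_of_le hpq (ne_top_of_le_ne_top ENNReal.one_ne_top hq1)]
    rfl

lemma threshold_eq_inv (hp : 1 ≤ p) (hb : 0 < b) :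
    threshold p b = (p⁻¹ + ENNReal.ofReal b)⁻¹ := by
  rcases eq_or_ne p ∞ with rfl | htop
  · rw [threshold, if_pos rfl, ENNReal.inv_top, zero_add, one_div, ENNReal.ofReal_inv_of_pos hb]
  · have hp0 := toReal_pos_of_one_le hp htop
    rw [threshold, if_neg htop, ← ENNReal.ofReal_toReal htop, ← ENNReal.ofReal_inv_of_pos hp0,
      ← ENNReal.ofReal_add (by positivity) hb.le, ← ENNReal.ofReal_inv_of_pos (by positivity),
      ENNReal.toReal_ofReal hp0.le]
    congr 1
    field_simp
    ring

lemma le_threshold_iff_bStar_nonpos (hp : 1 ≤ p) (hq : 1 ≤ q) (hb : 0 < b) :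
    q ≤ threshold p b ↔ bStar p q b ≤ 0 := by
  have hpinv : p⁻¹ ≠ ∞ := ENNReal.inv_ne_top.2 (zero_lt_one.trans_le hp).ne'
  have hqinv : q⁻¹ ≠ ∞ := ENNReal.inv_ne_top.2 (zero_lt_one.trans_le hq).ne'
  rw [threshold_eq_inv hp hb, ENNReal.le_inv_iff_le_inv,
    ← ENNReal.toReal_le_toReal (ENNReal.add_ne_top.2 ⟨hpinv, ENNReal.ofReal_ne_top⟩) hqinv,
    ENNReal.toReal_add hpinv ENNReal.ofReal_ne_top, ENNReal.toReal_ofReal hb.le, bStar,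
    sub_nonpos, add_comm]
  rfl

end Exponents

section Ellipsoid

variable {p q : ℝ≥0∞} {μ x : ℕ+ → ℝ}

lemma ellipsoidNorm_eq_seqNorm (p : ℝ≥0∞) (μ x : ℕ+ → ℝ) :
    ellipsoidNorm p μ x = seqNorm p fun n => x n / μ n := by
  simp only [ellipsoidNorm, seqNorm, Real.enorm_eq_ofReal_abs]

lemma seqNorm_div_le_one (hx : x ∈ ellipsoid p μ) : seqNorm p (fun n => x n / μ n) ≤ 1 :=
  (ellipsoidNorm_eq_seqNorm p μ x).symm.trans_le hx.2

lemma ellipsoidIn_nonempty (p q : ℝ≥0∞) [Fact (1 ≤ p)] (μ : ℕ+ → ℝ) :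
    (ellipsoidIn p q μ).Nonempty := by
  have hp : 1 ≤ p := Fact.out
  refine ⟨0, zero_memℓp, ?_⟩
  rw [ellipsoidNorm_eq_seqNorm]
  have zero_eq := seqNorm_const_mul hp 0 (0 : ℕ+ → ℝ)
  simp only [enorm_zero, zero_mul] at zero_eq
  simp [zero_eq]

lemma tendsto_mul_rpow_of_isLittleO {b c : ℝ}
    (hμ : (fun n : ℕ+ => μ n - c / (n : ℝ) ^ b) =o[atTop] fun n : ℕ+ => 1 / (n : ℝ) ^ b) :
    Tendsto (fun i : ℕ => μ i.succPNat * ((i : ℝ) + 1) ^ b) atTop (𝓝 c) := by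
  have succPNat_atTop : Tendsto Nat.succPNat atTop atTop :=
    tendsto_atTop.2 fun n => (eventually_ge_atTop (n : ℕ)).mono fun i hi =>
      PNat.coe_le_coe _ _ |>.1 (hi.trans i.le_succ)
  have := ((hμ.comp_tendsto succPNat_atTop).tendsto_div_nhds_zero).add_const c
  rw [zero_add] at this
  refine this.congr fun i => ?_
  have : (0 : ℝ) < ((i : ℝ) + 1) ^ b := by positivity
  simp only [Function.comp, Nat.succPNat_coe, Nat.succ_eq_add_one, Nat.cast_add, Nat.cast_one]
  field_simp
  ring

/-- The inclusion of the first `d` indices into `ℕ+`. -/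
def firstIndices (d : ℕ) (i : Fin d) : ℕ+ := (i : ℕ).succPNat

lemma firstIndices_injective (d : ℕ) : Function.Injective (firstIndices d) :=
  Nat.succPNat_injective.comp Fin.val_injective

lemma exists_firstIndices_eq_iff {d : ℕ} {n : ℕ+} :
    (∃ i, firstIndices d i = n) ↔ n.natPred < d :=
  ⟨by rintro ⟨i, rfl⟩; simp [firstIndices], fun h => ⟨⟨n.natPred, h⟩, by simp [firstIndices]⟩⟩

lemma memℓp_extend_firstIndices [Fact (1 ≤ p)] {d : ℕ} (y : Fin d → ℝ) :
    Memℓp (Function.extend (firstIndices d) y 0) p := by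
  rw [memℓp_iff_seqNorm_lt_top Fact.out,
    seqNorm_extend_zero Fact.out (firstIndices_injective d), seqNorm_eq_norm_toLp]
  exact ENNReal.ofReal_lt_top

end Ellipsoid

/-! ### Logarithmic asymptotics -/

section LogAsymptotics

lemma tendsto_log_div_id : Tendsto (fun y : ℝ => Real.log y / y) atTop (𝓝 0) :=
  Real.isLittleO_log_id_atTop.tendsto_div_nhds_zero

lemma tendsto_log_factorial_div_sub_log :
    Tendsto (fun n : ℕ => Real.log n.factorial / n - Real.log n) atTop (𝓝 (-1)) := by
  have log_stirlingSeq : Tendsto (fun n : ℕ => Real.log (Stirling.stirlingSeq n) / n) atTop (𝓝 0) :=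
    ((Real.continuousAt_log (Real.sqrt_pos.2 Real.pi_pos).ne').tendsto.comp
      Stirling.tendsto_stirlingSeq_sqrt_pi).div_atTop tendsto_natCast_atTop_atTop
  have log_two_mul : Tendsto (fun n : ℕ => Real.log (2 * n) / (2 * n)) atTop (𝓝 0) :=
    tendsto_log_div_id.comp
      (tendsto_natCast_atTop_atTop.const_mul_atTop (zero_lt_two (α := ℝ)))
  have h := (log_stirlingSeq.add log_two_mul).add_const (-1)
  rw [add_zero, zero_add] at h
  refine h.congr' ?_
  filter_upwards [eventually_gt_atTop 0] with n hn
  have hn' : (0 : ℝ) < n := by exact_mod_cast hn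
  rw [Stirling.log_stirlingSeq_formula, Real.log_div hn'.ne' (Real.exp_pos 1).ne', Real.log_exp]
  field_simp
  ring

lemma tendsto_floor_div_sub_one_mul_log :
    Tendsto (fun y : ℝ => ((⌊y⌋₊ : ℝ) / y - 1) * Real.log y) atTop (𝓝 0) := by
  refine squeeze_zero_norm' ?_ tendsto_log_div_id
  filter_upwards [eventually_ge_atTop 1] with y hy
  have hy0 : 0 < y := by linarith
  have abs_floor_sub : |(⌊y⌋₊ : ℝ) - y| ≤ 1 :=
    abs_le.2 ⟨by linarith [Nat.lt_floor_add_one y], by linarith [Nat.floor_le hy0.le]⟩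
  rw [norm_mul, Real.norm_of_nonneg (Real.log_nonneg hy), div_sub_one hy0.ne', norm_div,
    Real.norm_of_nonneg hy0.le, div_mul_eq_mul_div, Real.norm_eq_abs]
  gcongr
  exact mul_le_of_le_one_left (Real.log_nonneg hy) abs_floor_sub

lemma tendsto_log_factorial_floor_div_sub_log :
    Tendsto (fun y : ℝ => Real.log (⌊y⌋₊.factorial) / y - Real.log y) atTop (𝓝 (-1)) := by
  have ratio : Tendsto (fun y : ℝ => (⌊y⌋₊ : ℝ) / y) atTop (𝓝 1) := tendsto_nat_floor_div_atTop
  have log_ratio : Tendsto (fun y : ℝ => Real.log ((⌊y⌋₊ : ℝ) / y)) atTop (𝓝 0) := by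
    simpa [Function.comp_def] using (Real.continuousAt_log one_ne_zero).tendsto.comp ratio
  have h := ((ratio.mul (tendsto_log_factorial_div_sub_log.comp tendsto_nat_floor_atTop)).add
    (ratio.mul log_ratio)).add tendsto_floor_div_sub_one_mul_log
  simp only [one_mul, add_zero, Function.comp_def] at h
  refine h.congr' ?_
  filter_upwards [eventually_ge_atTop 1] with y hy
  have hy0 : 0 < y := by linarith
  have hfloor : (0 : ℝ) < ⌊y⌋₊ := by exact_mod_cast Nat.floor_pos.2 hy
  rw [Real.log_div hfloor.ne' hy0.ne']
  field_simp
  ring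

lemma factorial_floor_le_Gamma {y : ℝ} (hy : 1 ≤ y) :
    (⌊y⌋₊.factorial : ℝ) ≤ Real.Gamma (y + 1) := by
  have one_le_floor : (1 : ℝ) ≤ ⌊y⌋₊ := by exact_mod_cast Nat.le_floor (by simpa using hy)
  rw [← Real.Gamma_nat_eq_factorial]
  exact Real.Gamma_strictMonoOn_Ici.monotoneOn (Set.mem_Ici.2 (by linarith))
    (Set.mem_Ici.2 (by linarith)) (by linarith [Nat.floor_le (zero_le_one.trans hy)])

lemma Gamma_le_mul_factorial_floor {y : ℝ} (hy : 1 ≤ y) :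
    Real.Gamma (y + 1) ≤ 2 * y * ⌊y⌋₊.factorial := by
  have floor_le := Nat.floor_le (zero_le_one.trans hy)
  have le_floor := Nat.lt_floor_add_one y
  calc Real.Gamma (y + 1) ≤ Real.Gamma ((⌊y⌋₊ + 1 : ℕ) + 1) :=
        Real.Gamma_strictMonoOn_Ici.monotoneOn (Set.mem_Ici.2 (by linarith))
          (Set.mem_Ici.2 (by push_cast; linarith)) (by push_cast; linarith)
    _ = (⌊y⌋₊ + 1) * ⌊y⌋₊.factorial := by
        rw [Real.Gamma_nat_eq_factorial, Nat.factorial_succ]; push_cast; ring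
    _ ≤ 2 * y * ⌊y⌋₊.factorial := by gcongr; linarith

lemma tendsto_log_Gamma_sub_log_factorial_floor_div :
    Tendsto (fun y : ℝ => (Real.log (Real.Gamma (y + 1)) - Real.log (⌊y⌋₊.factorial)) / y)
      atTop (𝓝 0) := by
  have bound : Tendsto (fun y : ℝ => Real.log 2 / y + Real.log y / y) atTop (𝓝 0) := by
    simpa using (tendsto_const_nhds.div_atTop tendsto_id).add tendsto_log_div_id
  refine squeeze_zero' ?_ ?_ bound <;> filter_upwards [eventually_ge_atTop 1] with y hy
  all_goals
    have hy0 : 0 < y := by linarith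
    have hfact : (0 : ℝ) < ⌊y⌋₊.factorial := by exact_mod_cast Nat.factorial_pos _
  · exact div_nonneg (sub_nonneg.2 (Real.log_le_log hfact (factorial_floor_le_Gamma hy))) hy0.le
  · have log_le := Real.log_le_log (Real.Gamma_pos_of_pos (by linarith))
      (Gamma_le_mul_factorial_floor hy)
    rw [Real.log_mul (by positivity) hfact.ne', Real.log_mul two_ne_zero hy0.ne'] at log_le
    rw [← add_div]
    gcongr
    linarith

lemma tendsto_log_Gamma_div_sub_log :
    Tendsto (fun y : ℝ => Real.log (Real.Gamma (y + 1)) / y - Real.log y) atTop (𝓝 (-1)) := by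
  have h := tendsto_log_factorial_floor_div_sub_log.add
    tendsto_log_Gamma_sub_log_factorial_floor_div
  rw [add_zero] at h
  refine h.congr fun y => ?_
  rw [sub_div]
  ring

lemma tendsto_log_Gamma_natCast_mul {x : ℝ} (hx : 0 ≤ x) :
    Tendsto (fun d : ℕ => Real.log (Real.Gamma (d * x + 1)) / d - x * Real.log d) atTop
      (𝓝 (x * Real.log x - x)) := by
  rcases hx.eq_or_lt with rfl | hx
  · simp
  · have h := ((tendsto_log_Gamma_div_sub_log.comp
      (tendsto_natCast_atTop_atTop.atTop_mul_const hx)).mul_const x).add_const (x * Real.log x)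
    rw [show -1 * x + x * Real.log x = x * Real.log x - x by ring] at h
    refine h.congr' ?_
    filter_upwards [eventually_gt_atTop 0] with d hd
    have hd' : (0 : ℝ) < d := by exact_mod_cast hd
    rw [Function.comp_apply, Real.log_mul hd'.ne' hx.ne']
    field_simp
    ring

lemma log_factorial_eq_sum (d : ℕ) :
    Real.log d.factorial = ∑ i ∈ Finset.range d, Real.log ((i : ℝ) + 1) := by
  rw [← Finset.prod_range_add_one_eq_factorial, Nat.cast_prod,
    Real.log_prod fun i _ => by positivity]
  simp only [Nat.cast_add, Nat.cast_one]

variable {b c : ℝ} {u : ℕ → ℝ}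

lemma tendsto_log_add_mul_log (hc : 0 < c) (hpos : ∀ i, 0 < u i)
    (hu : Tendsto (fun i : ℕ => u i * ((i : ℝ) + 1) ^ b) atTop (𝓝 c)) :
    Tendsto (fun i : ℕ => Real.log (u i) + b * Real.log ((i : ℝ) + 1)) atTop (𝓝 (Real.log c)) := by
  refine ((Real.continuousAt_log hc.ne').tendsto.comp hu).congr fun i => ?_
  rw [Function.comp_apply, Real.log_mul (hpos i).ne' (by positivity), Real.log_rpow (by positivity)]

lemma tendsto_sum_log_div_add_mul_log (hc : 0 < c) (hpos : ∀ i, 0 < u i)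
    (hu : Tendsto (fun i : ℕ => u i * ((i : ℝ) + 1) ^ b) atTop (𝓝 c)) :
    Tendsto (fun d : ℕ => (∑ i ∈ Finset.range d, Real.log (u i)) / d + b * Real.log d)
      atTop (𝓝 (Real.log c + b)) := by
  have h := (tendsto_log_add_mul_log hc hpos hu).cesaro.sub
    (tendsto_log_factorial_div_sub_log.const_mul b)
  rw [show Real.log c - b * -1 = Real.log c + b by ring] at h
  refine h.congr fun d => ?_
  rw [Finset.sum_add_distrib, ← Finset.mul_sum, log_factorial_eq_sum]
  ring

lemma tendsto_sum_log_sub_mul_log_div (hc : 0 < c) (hpos : ∀ i, 0 < u i)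
    (hu : Tendsto (fun i : ℕ => u i * ((i : ℝ) + 1) ^ b) atTop (𝓝 c)) :
    Tendsto (fun d : ℕ => (∑ i ∈ Finset.range d, Real.log (u i) - d * Real.log (u d)) / d)
      atTop (𝓝 b) := by
  have h := ((tendsto_sum_log_div_add_mul_log hc hpos hu).sub
    (tendsto_log_add_mul_log hc hpos hu)).add (Real.tendsto_log_nat_add_one_sub_log.const_mul b)
  rw [mul_zero, add_zero, add_sub_cancel_left] at h
  refine h.congr' ?_
  filter_upwards [eventually_gt_atTop 0] with d hd
  have hd' : (d : ℝ) ≠ 0 := by exact_mod_cast hd.ne'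
  field_simp
  ring

end LogAsymptotics

/-! ### Volume comparison -/

section Volume

variable {κ : Type*} [Fintype κ]

/-- The Lebesgue volume of the unit ball of `ℓ^p` in dimension `d`. -/
noncomputable def lpBallVolume (p : ℝ≥0∞) (d : ℕ) : ℝ :=
  (2 * Real.Gamma (recip p + 1)) ^ d / Real.Gamma (d * recip p + 1)

lemma Gamma_recip_add_one_pos (p : ℝ≥0∞) : 0 < Real.Gamma (recip p + 1) :=
  Real.Gamma_pos_of_pos (by linarith [recip_nonneg p])

lemma lpBallVolume_pos (p : ℝ≥0∞) (d : ℕ) : 0 < lpBallVolume p d := by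
  have hp := recip_nonneg p
  have := Gamma_recip_add_one_pos p
  have := Real.Gamma_pos_of_pos (show 0 < d * recip p + 1 by positivity)
  unfold lpBallVolume
  positivity

lemma volume_seqNorm_le_one (p : ℝ≥0∞) [Fact (1 ≤ p)] [Nonempty κ] :
    volume {y : κ → ℝ | seqNorm p y ≤ 1} = ENNReal.ofReal (lpBallVolume p (Fintype.card κ)) := by
  simp only [seqNorm_eq_norm_toLp, ENNReal.ofReal_le_one]
  rcases eq_or_ne p ∞ with rfl | htop
  · have unit_ball : {y : κ → ℝ | ‖WithLp.toLp ∞ y‖ ≤ 1} = Metric.closedBall 0 1 := by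
      ext y
      simp [PiLp.norm_toLp]
    rw [unit_ball, Real.volume_pi_closedBall _ zero_le_one]
    simp [lpBallVolume, recip]
  · have hp0 := toReal_pos_of_one_le Fact.out htop
    have hp1 : 1 ≤ p.toReal := ENNReal.toReal_mono htop (Fact.out : 1 ≤ p)
    have := volume_sum_rpow_le κ hp1 1
    simp only [ENNReal.ofReal_one, one_pow, one_mul] at this
    simp only [PiLp.norm_eq_sum hp0, Real.norm_eq_abs]
    rw [this, lpBallVolume, recip_eq_inv_toReal, one_div, div_eq_mul_inv (Fintype.card κ : ℝ)]

lemma volume_seqNorm_sub_div_le_one (p : ℝ≥0∞) [Fact (1 ≤ p)] [Nonempty κ] {a : κ → ℝ}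
    (ha : ∀ i, 0 < a i) (z : κ → ℝ) :
    volume {y : κ → ℝ | seqNorm p (fun i => (y i - z i) / a i) ≤ 1} =
      ENNReal.ofReal ((∏ i, a i) * lpBallVolume p (Fintype.card κ)) := by
  classical
  have hprod : 0 < ∏ i, a i := Finset.prod_pos fun i _ => ha i
  set T := Matrix.toLin' (Matrix.diagonal fun i => (a i)⁻¹) with hT
  have hdet : LinearMap.det T = (∏ i, a i)⁻¹ := by
    rw [LinearMap.det_toLin', Matrix.det_diagonal, Finset.prod_inv_distrib]
  have preimage_eq : {y : κ → ℝ | seqNorm p (fun i => (y i - z i) / a i) ≤ 1} =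
      (fun y => y + -z) ⁻¹' (T ⁻¹' {y : κ → ℝ | seqNorm p y ≤ 1}) := by
    ext y
    have : T (y + -z) = fun i => (y i - z i) / a i := by
      funext i
      rw [hT, Matrix.toLin'_apply, Matrix.mulVec_diagonal, Pi.add_apply, Pi.neg_apply,
        ← sub_eq_add_neg, div_eq_inv_mul]
    simp only [Set.mem_preimage, Set.mem_ofPred_eq, this]
  rw [preimage_eq, measure_preimage_add_right, Measure.addHaar_preimage_linearMap volume
    (by rw [hdet]; exact inv_ne_zero hprod.ne'), hdet, inv_inv, abs_of_pos hprod,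
    volume_seqNorm_le_one p, ← ENNReal.ofReal_mul hprod.le]

lemma prod_mul_lpBallVolume_le_card_mul {p q : ℝ≥0∞} [Fact (1 ≤ p)] [Fact (1 ≤ q)] [Nonempty κ]
    {a : κ → ℝ} (ha : ∀ i, 0 < a i) {ε : ℝ} (hε : 0 < ε) (S : Finset (κ → ℝ))
    (hS : ∀ y : κ → ℝ, seqNorm p (fun i => y i / a i) ≤ 1 →
      ∃ z ∈ S, seqNorm q (y - z) ≤ ENNReal.ofReal ε) :
    (∏ i, a i) * lpBallVolume p (Fintype.card κ) ≤
      S.card * (ε ^ Fintype.card κ * lpBallVolume q (Fintype.card κ)) := by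
  have hVq := lpBallVolume_pos q (Fintype.card κ)
  have subset_iUnion : {y : κ → ℝ | seqNorm p (fun i => (y i - (0 : κ → ℝ) i) / a i) ≤ 1} ⊆
      ⋃ z ∈ S, {y : κ → ℝ | seqNorm q (fun i => (y i - z i) / ε) ≤ 1} := by
    intro y hy
    simp only [Pi.zero_apply, sub_zero, Set.mem_ofPred_eq] at hy
    obtain ⟨z, hz, hyz⟩ := hS y hy
    refine Set.mem_biUnion hz ?_
    simp only [Set.mem_ofPred_eq, div_eq_inv_mul]
    rw [seqNorm_const_mul Fact.out, Real.enorm_of_nonneg (by positivity),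
      ENNReal.ofReal_inv_of_pos hε]
    exact (mul_le_mul_right hyz _).trans (ENNReal.inv_mul_le_one _)
  have hvol := (measure_mono subset_iUnion).trans (measure_biUnion_finset_le (μ := volume) _ _)
  rw [volume_seqNorm_sub_div_le_one p ha] at hvol
  simp only [volume_seqNorm_sub_div_le_one q fun _ : κ => hε] at hvol
  rwa [Finset.sum_const, nsmul_eq_mul, Finset.prod_const, Finset.card_univ,
    ← ENNReal.ofReal_natCast, ← ENNReal.ofReal_mul (by positivity),
    ENNReal.ofReal_le_ofReal_iff (by positivity)] at hvol

end Volume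

section EllipsoidVolume

variable {p q : ℝ≥0∞} [Fact (1 ≤ p)] [Fact (1 ≤ q)] {μ : ℕ+ → ℝ} {ε : ℝ} {d : ℕ}

lemma extend_firstIndices_mem_ellipsoid {y : Fin d → ℝ}
    (hy : seqNorm p (fun i => y i / μ (firstIndices d i)) ≤ 1) :
    Function.extend (firstIndices d) y 0 ∈ ellipsoid p μ := by
  refine ⟨memℓp_extend_firstIndices y, ?_⟩
  have extend_div : (fun n => Function.extend (firstIndices d) y 0 n / μ n) =
      Function.extend (firstIndices d) (fun i => y i / μ (firstIndices d i)) 0 := by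
    funext n
    by_cases hn : ∃ i, firstIndices d i = n
    · obtain ⟨i, rfl⟩ := hn
      simp only [(firstIndices_injective d).extend_apply]
    · simp [Function.extend_apply' _ _ _ hn]
  rwa [ellipsoidNorm_eq_seqNorm, extend_div,
    seqNorm_extend_zero Fact.out (firstIndices_injective d)]

lemma prod_mul_lpBallVolume_le_ncard_mul (hpos : ∀ n, 0 < μ n) (hε : 0 < ε) (hd : 0 < d)
    {C : Set (lp (fun _ : ℕ+ => ℝ) q)} (hfin : C.Finite)
    (hC : Metric.IsCover ε.toNNReal (ellipsoidIn p q μ) C) :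
    (∏ i, μ (firstIndices d i)) * lpBallVolume p d ≤ C.ncard * (ε ^ d * lpBallVolume q d) := by
  classical
  have : Nonempty (Fin d) := ⟨⟨0, hd⟩⟩
  set S : Finset (Fin d → ℝ) :=
    hfin.toFinset.image fun x : lp (fun _ : ℕ+ => ℝ) q => (x : ℕ+ → ℝ) ∘ firstIndices d
  have head_cover (y : Fin d → ℝ) (hy : seqNorm p (fun i => y i / μ (firstIndices d i)) ≤ 1) :
      ∃ z ∈ S, seqNorm q (y - z) ≤ ENNReal.ofReal ε := by
    obtain ⟨x, hx, hyx⟩ :=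
      hC (show ⟨_, memℓp_extend_firstIndices y⟩ ∈ ellipsoidIn p q μ from
        extend_firstIndices_mem_ellipsoid hy)
    refine ⟨_, Finset.mem_image_of_mem _ (hfin.mem_toFinset.2 hx), ?_⟩
    refine le_trans ?_ ((edist_lp_eq_seqNorm _ _).symm.trans_le hyx)
    refine le_of_eq_of_le ?_ (seqNorm_comp_le (firstIndices_injective d) _)
    congr 1
    funext i
    simp [(firstIndices_injective d).extend_apply]
  have hcard : (S.card : ℝ) ≤ C.ncard := by
    rw [Set.ncard_eq_toFinset_card C hfin]
    exact_mod_cast Finset.card_image_le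
  have hVq := lpBallVolume_pos q d
  refine le_trans ?_ (mul_le_mul_of_nonneg_right hcard (by positivity))
  simpa only [Fintype.card_fin] using
    prod_mul_lpBallVolume_le_card_mul (fun i => hpos (firstIndices d i)) hε S head_cover

lemma le_metricEntropy_of_volume (hpos : ∀ n, 0 < μ n) (hε : 0 < ε) (hd : 0 < d) :
    (((∑ i ∈ Finset.range d, Real.log (μ i.succPNat) + Real.log (lpBallVolume p d) -
      Real.log (lpBallVolume q d) - d * Real.log ε) / Real.log 2 : ℝ) : EReal) ≤
      metricEntropy ε (ellipsoidIn p q μ) := by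
  have hVp := lpBallVolume_pos p d
  have hVq := lpBallVolume_pos q d
  have hprod : 0 < ∏ i, μ (firstIndices d i) := Finset.prod_pos fun i _ => hpos _
  have h := le_metricEntropy_of_forall_isCover (ε := ε) (A := ellipsoidIn p q μ)
    (N := (∏ i, μ (firstIndices d i)) * lpBallVolume p d / (ε ^ d * lpBallVolume q d))
    (by positivity) fun C hfin hC => (div_le_iff₀ (by positivity)).2
      (prod_mul_lpBallVolume_le_ncard_mul hpos hε hd hfin hC)
  rw [Real.log_div (by positivity) (by positivity), Real.log_mul hprod.ne' hVp.ne',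
    Real.log_mul (by positivity) hVq.ne', Real.log_pow, Real.log_prod fun i _ => (hpos _).ne'] at h
  rw [Finset.sum_range]
  convert h using 3
  simp only [firstIndices]
  ring

end EllipsoidVolume

section VolumeAsymptotics

variable {p q : ℝ≥0∞}

lemma tendsto_log_lpBallVolume_div_add (p : ℝ≥0∞) :
    Tendsto (fun d : ℕ => Real.log (lpBallVolume p d) / d + recip p * Real.log d) atTop
      (𝓝 (Real.log 2 + Real.log (Real.Gamma (recip p + 1)) -
        (recip p * Real.log (recip p) - recip p))) := by
  have hp := recip_nonneg p
  have hΓ := Gamma_recip_add_one_pos p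
  refine ((tendsto_log_Gamma_natCast_mul hp).const_sub
    (Real.log 2 + Real.log (Real.Gamma (recip p + 1)))).congr' ?_
  filter_upwards [eventually_gt_atTop 0] with d hd
  have : (0 : ℝ) < d := by exact_mod_cast hd
  have hΓd := Real.Gamma_pos_of_pos (show 0 < d * recip p + 1 by positivity)
  rw [lpBallVolume, Real.log_div (by positivity) hΓd.ne', Real.log_pow,
    Real.log_mul two_ne_zero hΓ.ne']
  field_simp
  ring

lemma selfRoot_pos (hp : 1 ≤ p) : 0 < selfRoot p := by
  unfold selfRoot
  split_ifs with htop
  · exact one_pos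
  · exact Real.rpow_pos_of_pos (toReal_pos_of_one_le hp htop) _

lemma log_selfRoot (hp : 1 ≤ p) : Real.log (selfRoot p) = -(recip p * Real.log (recip p)) := by
  unfold selfRoot
  split_ifs with htop
  · simp [htop, recip]
  · rw [Real.log_rpow (toReal_pos_of_one_le hp htop), recip_eq_inv_toReal, Real.log_inv]
    ring

lemma GammaConst_pos (hp : 1 ≤ p) (hq : 1 ≤ q) : 0 < GammaConst p q := by
  have := selfRoot_pos hp
  have := selfRoot_pos hq
  have := Gamma_recip_add_one_pos p
  have := Gamma_recip_add_one_pos q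
  unfold GammaConst
  positivity

lemma log_GammaConst (hp : 1 ≤ p) (hq : 1 ≤ q) :
    Real.log (GammaConst p q) =
      (Real.log (Real.Gamma (recip p + 1)) - (recip p * Real.log (recip p) - recip p)) -
      (Real.log (Real.Gamma (recip q + 1)) - (recip q * Real.log (recip q) - recip q)) := by
  have hp0 := selfRoot_pos hp
  have hq0 := selfRoot_pos hq
  have hΓp := Gamma_recip_add_one_pos p
  have hΓq := Gamma_recip_add_one_pos q
  rw [GammaConst, Real.log_div (by positivity) (by positivity), Real.log_mul hΓp.ne' hp0.ne',
    Real.log_mul (by positivity) (by positivity), Real.log_mul hΓq.ne' hq0.ne', Real.log_exp,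
    log_selfRoot hp, log_selfRoot hq]
  ring

lemma tendsto_log_volume_ratio_div_add (hp : 1 ≤ p) (hq : 1 ≤ q) {b c : ℝ} (hc : 0 < c) {u : ℕ → ℝ}
    (hpos : ∀ i, 0 < u i) (hu : Tendsto (fun i : ℕ => u i * ((i : ℝ) + 1) ^ b) atTop (𝓝 c)) :
    Tendsto (fun d : ℕ => (∑ i ∈ Finset.range d, Real.log (u i) + Real.log (lpBallVolume p d) -
      Real.log (lpBallVolume q d)) / d + bStar p q b * Real.log d) atTop
      (𝓝 (Real.log (GammaConst p q * c) + b)) := by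
  have h := ((tendsto_sum_log_div_add_mul_log hc hpos hu).add
    (tendsto_log_lpBallVolume_div_add p)).sub (tendsto_log_lpBallVolume_div_add q)
  convert! h using 1
  · funext d
    rw [bStar]
    ring
  · rw [Real.log_mul (GammaConst_pos hp hq).ne' hc.ne', log_GammaConst hp hq]
    ring_nf

lemma eventually_le_metricEntropy_rpow [Fact (1 ≤ p)] [Fact (1 ≤ q)] {b c : ℝ} (hc : 0 < c)
    {μ : ℕ+ → ℝ} (hpos : ∀ n, 0 < μ n)
    (hμ : Tendsto (fun i : ℕ => μ i.succPNat * ((i : ℝ) + 1) ^ b) atTop (𝓝 c))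
    {h : ℝ} (hh : h < b / Real.log 2) :
    ∀ᶠ d : ℕ in atTop, ((h * d : ℝ) : EReal) ≤
      metricEntropy (GammaConst p q * c * (d : ℝ) ^ (-bStar p q b)) (ellipsoidIn p q μ) := by
  have hp : 1 ≤ p := Fact.out
  have hq : 1 ≤ q := Fact.out
  have hK : 0 < GammaConst p q * c := mul_pos (GammaConst_pos hp hq) hc
  have hlog2 := Real.log_pos one_lt_two
  have lim := (tendsto_log_volume_ratio_div_add hp hq hc (fun i => hpos i.succPNat) hμ).sub_const
    (Real.log (GammaConst p q * c))
  rw [add_sub_cancel_left] at lim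
  filter_upwards [lim.eventually (lt_mem_nhds ((lt_div_iff₀ hlog2).1 hh)), eventually_gt_atTop 0]
    with d hd hd0
  have hd' : (0 : ℝ) < d := by exact_mod_cast hd0
  refine le_trans (EReal.coe_le_coe_iff.2 ?_)
    (le_metricEntropy_of_volume hpos (by positivity) hd0)
  rw [le_div_iff₀ hlog2, Real.log_mul hK.ne' (by positivity), Real.log_rpow hd']
  have := mul_le_mul_of_nonneg_left hd.le hd'.le
  field_simp at this
  linarith

lemma metricEntropy_eq_top_of_bStar_nonpos [Fact (1 ≤ p)] [Fact (1 ≤ q)] {b c : ℝ} (hb : 0 < b)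
    (hc : 0 < c) {μ : ℕ+ → ℝ} (hpos : ∀ n, 0 < μ n)
    (hμ : Tendsto (fun i : ℕ => μ i.succPNat * ((i : ℝ) + 1) ^ b) atTop (𝓝 c))
    (hB : bStar p q b ≤ 0) {ε : ℝ} (hε : ε < GammaConst p q * c) :
    metricEntropy ε (ellipsoidIn p q μ) = ⊤ := by
  have hK : 0 < GammaConst p q * c := mul_pos (GammaConst_pos Fact.out Fact.out) hc
  have := Real.log_pos one_lt_two
  have rate_pos : 0 < b / Real.log 2 / 2 := by positivity
  refine EReal.eq_top_iff_forall_lt _ |>.2 fun y => ?_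
  obtain ⟨d, hd, hdy, hd1⟩ := ((eventually_le_metricEntropy_rpow (p := p) (q := q) hc hpos hμ
    (half_lt_self (by positivity : 0 < b / Real.log 2))).and
    (((tendsto_natCast_atTop_atTop.const_mul_atTop rate_pos).eventually_gt_atTop y).and
      (eventually_ge_atTop 1))).exists
  have hd1' : (1 : ℝ) ≤ d := by exact_mod_cast hd1
  refine (EReal.coe_lt_coe_iff.2 hdy).trans_le (hd.trans (metricEntropy_antitone _ ?_))
  exact hε.le.trans (le_mul_of_one_le_right hK.le (Real.one_le_rpow hd1' (by linarith)))

end VolumeAsymptotics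

/-! ### From scales indexed by the dimension to arbitrary radii -/

section Inversion

variable {H : ℝ → EReal} {K B h : ℝ}

lemma tendsto_div_rpow_atTop (hK : 0 < K) (hB : 0 < B) :
    Tendsto (fun ε : ℝ => (K / ε) ^ (1 / B)) (𝓝[>] 0) atTop :=
  (tendsto_rpow_atTop (one_div_pos.2 hB)).comp
    (tendsto_inv_nhdsGT_zero.const_mul_atTop hK)

lemma div_rpow_eq_mul (hK : 0 < K) {ε : ℝ} (hε : 0 < ε) :
    (K / ε) ^ (1 / B) = K ^ (1 / B) * ε ^ (-(1 / B)) := by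
  rw [Real.div_rpow hK.le hε.le, Real.rpow_neg hε.le, div_eq_mul_inv]

lemma mul_div_rpow_rpow_neg (hK : 0 < K) (hB : 0 < B) {ε : ℝ} (hε : 0 < ε) :
    K * ((K / ε) ^ (1 / B)) ^ (-B) = ε := by
  rw [← Real.rpow_mul (by positivity), show 1 / B * -B = -1 by field_simp, Real.rpow_neg_one,
    inv_div, mul_div_cancel₀ _ hK.ne']

lemma eventually_nhdsGT_of_eventually_rpow (hK : 0 < K) (hB : 0 < B) {P : ℝ → ℝ → Prop}
    (hP : ∀ᶠ t : ℝ in atTop, P t (K * t ^ (-B))) :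
    ∀ᶠ ε in 𝓝[>] 0, P ((K / ε) ^ (1 / B)) ε := by
  filter_upwards [(tendsto_div_rpow_atTop hK hB).eventually hP, self_mem_nhdsWithin] with ε hε hε0
  rwa [mul_div_rpow_rpow_neg hK hB hε0] at hε

lemma eventually_mul_le_of_forall_nat (hH : Antitone H) (hK : 0 < K) (hB : 0 < B)
    (hd : ∀ h' < h, ∀ᶠ d : ℕ in atTop, ((h' * d : ℝ) : EReal) ≤ H (K * (d : ℝ) ^ (-B)))
    {h' : ℝ} (hh' : h' < h) :
    ∀ᶠ t : ℝ in atTop, ((h' * t : ℝ) : EReal) ≤ H (K * t ^ (-B)) := by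
  obtain ⟨m, hm, hmh⟩ := exists_between hh'
  have lim : Tendsto (fun t : ℝ => m * (⌊t⌋₊ / t)) atTop (𝓝 m) := by
    simpa using tendsto_nat_floor_div_atTop.const_mul m
  filter_upwards [lim.eventually (lt_mem_nhds hm), tendsto_nat_floor_atTop.eventually (hd m hmh),
    eventually_ge_atTop 1] with t ht htd ht1
  have ht0 : 0 < t := by linarith
  have floor_pos : (0 : ℝ) < ⌊t⌋₊ := by exact_mod_cast Nat.floor_pos.2 ht1
  refine (EReal.coe_le_coe_iff.2 ?_).trans (htd.trans (hH ?_))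
  · rw [← mul_div_assoc, lt_div_iff₀ ht0] at ht
    exact ht.le
  · exact mul_le_mul_of_nonneg_left
      (Real.rpow_le_rpow_of_nonpos floor_pos (Nat.floor_le ht0.le) (by linarith)) hK.le

lemma exists_pos_add_mul_rpow_lt (h a : ℝ) {h' : ℝ} (hh' : h < h') :
    ∃ κ : ℝ, 0 < κ ∧ (h + κ) * (1 + κ) ^ a < h' := by
  have lim : Tendsto (fun κ : ℝ => (h + κ) * (1 + κ) ^ a) (𝓝 0) (𝓝 h) := by
    have : ContinuousAt (fun κ : ℝ => (h + κ) * (1 + κ) ^ a) 0 :=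
      (continuousAt_const.add continuousAt_id).mul
        ((continuousAt_const.add continuousAt_id).rpow_const (by simp))
    simpa [ContinuousAt] using this
  obtain ⟨κ, hκ, hκ0⟩ := ((lim.mono_left nhdsWithin_le_nhds).eventually (gt_mem_nhds hh') |>.and
    (self_mem_nhdsWithin : Set.Ioi (0 : ℝ) ∈ 𝓝[>] 0)).exists
  exact ⟨κ, hκ0, hκ⟩

lemma eventually_le_mul_of_forall_nat (hH : Antitone H) (hK : 0 < K) (hB : 0 < B)
    (hd : ∀ κ > 0, ∀ᶠ d : ℕ in atTop,
      H ((1 + κ) * K * (d : ℝ) ^ (-B)) ≤ (((h + κ) * d : ℝ) : EReal))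
    {h' : ℝ} (hh' : h < h') :
    ∀ᶠ t : ℝ in atTop, H (K * t ^ (-B)) ≤ ((h' * t : ℝ) : EReal) := by
  obtain ⟨κ, hκ, hκh⟩ := exists_pos_add_mul_rpow_lt h (1 / B) hh'
  set s := (1 + κ) ^ (1 / B) with hs
  have hs0 : 0 < s := by positivity
  have s_rpow : s ^ (-B) = (1 + κ)⁻¹ := by
    rw [hs, ← Real.rpow_mul (by positivity), show 1 / B * -B = -1 by field_simp, Real.rpow_neg_one]
  have lim : Tendsto (fun t : ℝ => (h + κ) * (⌈s * t⌉₊ / t)) atTop (𝓝 ((h + κ) * s)) :=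
    (tendsto_nat_ceil_mul_div_atTop hs0.le).const_mul _
  filter_upwards [lim.eventually (gt_mem_nhds hκh),
    (tendsto_nat_ceil_atTop.comp (tendsto_id.const_mul_atTop hs0)).eventually (hd κ hκ),
    eventually_gt_atTop 0] with t ht htd ht0
  refine ((hH ?_).trans htd).trans (EReal.coe_le_coe_iff.2 ?_)
  · calc (1 + κ) * K * (⌈s * t⌉₊ : ℝ) ^ (-B)
        ≤ (1 + κ) * K * (s * t) ^ (-B) := mul_le_mul_of_nonneg_left
          (Real.rpow_le_rpow_of_nonpos (by positivity) (Nat.le_ceil _) (by linarith))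
          (by positivity)
      _ = K * t ^ (-B) := by
          rw [Real.mul_rpow hs0.le ht0.le, s_rpow]
          field_simp
  · rw [← mul_div_assoc, div_lt_iff₀ ht0] at ht
    exact ht.le

end Inversion

section RemainderTerms

variable {H : ℝ → EReal} {K B h : ℝ}

lemma exists_isLittleO_le {m g : ℝ → ℝ} (hH : ∀ ε, 0 ≤ H ε) (hg : ∀ ε, 0 < ε → 0 ≤ g ε)
    (h : ∀ η : ℝ, 0 < η → ∀ᶠ ε in 𝓝[>] 0, ((m ε - η * g ε : ℝ) : EReal) ≤ H ε) :
    ∃ r : ℝ → ℝ, r =o[𝓝[>] 0] g ∧ ∀ ε : ℝ, 0 < ε → ((m ε + r ε : ℝ) : EReal) ≤ H ε := by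
  classical
  have H_ne_bot ε : H ε ≠ ⊥ := (EReal.bot_lt_zero.trans_le (hH ε)).ne'
  refine ⟨fun ε => if H ε = ⊤ then 0 else min 0 ((H ε).toReal - m ε), ?_, fun ε _ => ?_⟩
  · refine isLittleO_iff.2 fun η hη => ?_
    filter_upwards [h η hη, self_mem_nhdsWithin] with ε hm hε
    have hg0 := hg ε hε
    split_ifs with htop
    · rw [norm_zero]
      positivity
    · rw [← EReal.coe_toReal htop (H_ne_bot ε), EReal.coe_le_coe_iff] at hm
      rw [Real.norm_of_nonpos (min_le_left _ _), Real.norm_of_nonneg hg0, neg_le]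
      exact le_min (by nlinarith) (by linarith)
  · beta_reduce
    split_ifs with htop
    · exact htop ▸ le_top
    · refine (EReal.coe_le_coe_iff.2 ?_).trans (EReal.coe_toReal htop (H_ne_bot ε)).le
      linarith [min_le_right 0 ((H ε).toReal - m ε)]

lemma exists_le_isLittleO {m g : ℝ → ℝ} (hH : ∀ ε, 0 ≤ H ε) (hHtop : ∀ ε, 0 < ε → H ε ≠ ⊤)
    (hg : ∀ ε, 0 < ε → 0 ≤ g ε)
    (h : ∀ η : ℝ, 0 < η → ∀ᶠ ε in 𝓝[>] 0, H ε ≤ ((m ε + η * g ε : ℝ) : EReal)) :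
    ∃ r : ℝ → ℝ, r =o[𝓝[>] 0] g ∧ ∀ ε : ℝ, 0 < ε → H ε ≤ ((m ε + r ε : ℝ) : EReal) := by
  have H_ne_bot ε : H ε ≠ ⊥ := (EReal.bot_lt_zero.trans_le (hH ε)).ne'
  refine ⟨fun ε => max 0 ((H ε).toReal - m ε), ?_, fun ε hε => ?_⟩
  · refine isLittleO_iff.2 fun η hη => ?_
    filter_upwards [h η hη, self_mem_nhdsWithin] with ε hm hε
    have hg0 := hg ε hε
    rw [← EReal.coe_toReal (hHtop ε hε) (H_ne_bot ε), EReal.coe_le_coe_iff] at hm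
    rw [Real.norm_of_nonneg (le_max_left _ _), Real.norm_of_nonneg hg0]
    exact max_le (by positivity) (by linarith)
  · refine (EReal.coe_toReal (hHtop ε hε) (H_ne_bot ε)).ge.trans (EReal.coe_le_coe_iff.2 ?_)
    linarith [le_max_right 0 ((H ε).toReal - m ε)]

lemma exists_isLittleO_le_of_forall_nat (hH : Antitone H) (hH0 : ∀ ε, 0 ≤ H ε) (hK : 0 < K)
    (hB : 0 < B)
    (hd : ∀ h' < h, ∀ᶠ d : ℕ in atTop, ((h' * d : ℝ) : EReal) ≤ H (K * (d : ℝ) ^ (-B))) :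
    ∃ r : ℝ → ℝ, (r =o[𝓝[>] 0] fun ε => ε ^ (-(1 / B))) ∧
      ∀ ε : ℝ, 0 < ε → ((h * (K / ε) ^ (1 / B) + r ε : ℝ) : EReal) ≤ H ε := by
  refine exists_isLittleO_le hH0 (fun ε hε => by positivity) fun η hη => ?_
  have : 0 < K ^ (1 / B) := by positivity
  filter_upwards [eventually_nhdsGT_of_eventually_rpow hK hB
    (P := fun t ε => (((h - η / K ^ (1 / B)) * t : ℝ) : EReal) ≤ H ε)
    (eventually_mul_le_of_forall_nat hH hK hB hd (sub_lt_self h (by positivity))),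
    self_mem_nhdsWithin] with ε hle hε
  convert hle using 2
  rw [div_rpow_eq_mul hK hε]
  field_simp

lemma exists_le_isLittleO_of_forall_nat (hH : Antitone H) (hH0 : ∀ ε, 0 ≤ H ε) (hK : 0 < K)
    (hB : 0 < B)
    (hd : ∀ κ > 0, ∀ᶠ d : ℕ in atTop,
      H ((1 + κ) * K * (d : ℝ) ^ (-B)) ≤ (((h + κ) * d : ℝ) : EReal)) :
    ∃ r : ℝ → ℝ, (r =o[𝓝[>] 0] fun ε => ε ^ (-(1 / B))) ∧
      ∀ ε : ℝ, 0 < ε → H ε ≤ ((h * (K / ε) ^ (1 / B) + r ε : ℝ) : EReal) := by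
  have : 0 < K ^ (1 / B) := by positivity
  have eventually_le (h' : ℝ) (hh' : h < h') :
      ∀ᶠ ε in 𝓝[>] 0, H ε ≤ ((h' * (K / ε) ^ (1 / B) : ℝ) : EReal) :=
    eventually_nhdsGT_of_eventually_rpow hK hB (P := fun t ε => H ε ≤ ((h' * t : ℝ) : EReal))
      (eventually_le_mul_of_forall_nat hH hK hB hd hh')
  refine exists_le_isLittleO hH0 (fun ε hε => ?_) (fun ε hε => by positivity) fun η hη => ?_
  · obtain ⟨ε', hε', hlt⟩ :=
      ((eventually_le (h + 1) (lt_add_one h)).and (Ioo_mem_nhdsGT hε)).exists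
    exact ne_top_of_le_ne_top (EReal.coe_ne_top _) ((hH hlt.2.le).trans hε')
  · filter_upwards [eventually_le (h + η / K ^ (1 / B)) (lt_add_of_pos_right h (by positivity)),
      self_mem_nhdsWithin] with ε hle hε
    convert hle using 2
    rw [div_rpow_eq_mul hK hε]
    field_simp

lemma eventually_le_mul_of_le {g u : ℝ → ℝ} (hg : ∀ ε, 0 < ε → 0 ≤ g ε)
    (hu : Tendsto u (𝓝[>] 0) atTop)
    (h : ∃ C : ℝ, 0 < C ∧ ∀ᶠ ε in 𝓝[>] 0, H ε ≤ ((C * g ε : ℝ) : EReal)) :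
    ∃ C : ℝ, 0 < C ∧ ∀ᶠ ε in 𝓝[>] 0, H ε ≤ ((C * (g ε * u ε) : ℝ) : EReal) := by
  obtain ⟨C, hC, h⟩ := h
  refine ⟨C, hC, ?_⟩
  filter_upwards [hu.eventually_ge_atTop 1, h, self_mem_nhdsWithin] with ε hu1 hHε hε
  refine hHε.trans (EReal.coe_le_coe_iff.2 ?_)
  gcongr
  exact le_mul_of_one_le_right (hg ε hε) hu1

lemma tendsto_logb_inv : Tendsto (fun ε : ℝ => Real.logb 2 ε⁻¹) (𝓝[>] 0) atTop :=
  (Real.tendsto_logb_atTop one_lt_two).comp tendsto_inv_nhdsGT_zero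

end RemainderTerms

/-! ### Counting lattice points with exponential weights -/

section LatticeCounting

/-- The logarithm of `∑_{k ∈ ℤ} e ^ (-y |k|)`, in closed form; it bounds the contribution of one
coordinate of weight `y` to the logarithmic number of integer points of a weighted `ℓ^1` ball. -/
noncomputable def logLatticeSum (y : ℝ) : ℝ := Real.log (1 + 2 / (Real.exp y - 1))

lemma two_div_exp_sub_one_pos {y : ℝ} (hy : 0 < y) : 0 < 2 / (Real.exp y - 1) :=
  div_pos two_pos (sub_pos.2 (Real.one_lt_exp_iff.2 hy))

lemma logLatticeSum_nonneg {y : ℝ} (hy : 0 < y) : 0 ≤ logLatticeSum y :=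
  Real.log_nonneg (le_add_of_nonneg_right (two_div_exp_sub_one_pos hy).le)

lemma hasSum_exp_neg_mul_abs_int {y : ℝ} (hy : 0 < y) :
    HasSum (fun k : ℤ => Real.exp (-(y * |(k : ℝ)|))) (Real.exp (logLatticeSum y)) := by
  have ratio_lt_one : Real.exp (-y) < 1 := by simpa using hy
  have sum_pos : HasSum (fun n : ℕ => Real.exp (-(y * |((n + 1 : ℤ) : ℝ)|)))
      (Real.exp (-y) * (1 - Real.exp (-y))⁻¹) := by
    refine ((hasSum_geometric_of_lt_one (Real.exp_pos _).le ratio_lt_one).mul_left _).congr_fun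
      fun n => ?_
    have abs_succ : |((n + 1 : ℤ) : ℝ)| = n + 1 := by
      push_cast
      exact abs_of_nonneg (by positivity)
    rw [← pow_succ', ← Real.exp_nat_mul, abs_succ]
    push_cast
    ring_nf
  have sum_neg : HasSum (fun n : ℕ => Real.exp (-(y * |((-(n + 1 : ℤ) : ℤ) : ℝ)|)))
      (Real.exp (-y) * (1 - Real.exp (-y))⁻¹) :=
    sum_pos.congr_fun fun n => by rw [Int.cast_neg, abs_neg]
  convert! HasSum.of_add_one_of_neg_add_one (f := fun k : ℤ => Real.exp (-(y * |(k : ℝ)|)))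
    sum_pos sum_neg using 1
  have exp_sub_one_pos : 0 < Real.exp y - 1 := sub_pos.2 (Real.one_lt_exp_iff.2 hy)
  have geometric : Real.exp (-y) * (1 - Real.exp (-y))⁻¹ = 1 / (Real.exp y - 1) := by
    have : 1 - Real.exp (-y) ≠ 0 := by linarith
    rw [Real.exp_neg] at *
    field_simp
  rw [logLatticeSum, Real.exp_log (by linarith [two_div_exp_sub_one_pos hy]), geometric]
  simp only [Int.cast_zero, abs_zero, mul_zero, neg_zero, Real.exp_zero]
  ring

lemma log_one_add_le_rpow_div {x θ : ℝ} (hx : 0 ≤ x) (hθ : 0 < θ) (hθ1 : θ ≤ 1) :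
    Real.log (1 + x) ≤ x ^ θ / θ := by
  have subadditive : (1 + x) ^ θ ≤ 1 + x ^ θ := by
    simpa using Real.rpow_add_le_add_rpow zero_le_one hx hθ.le hθ1
  have := Real.log_le_sub_one_of_pos (show 0 < (1 + x) ^ θ by positivity)
  rw [Real.log_rpow (by positivity)] at this
  rw [le_div_iff₀ hθ]
  linarith

lemma pow_div_factorial_le_exp_sub_one {y : ℝ} (hy : 0 ≤ y) {N : ℕ} (hN : 0 < N) :
    y ^ N / N.factorial ≤ Real.exp y - 1 := by
  have := Real.sum_le_exp_of_nonneg hy (N + 1)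
  rw [Finset.sum_range_succ] at this
  have one_le : (1 : ℝ) ≤ ∑ i ∈ Finset.range N, y ^ i / i.factorial := by
    simpa using Finset.single_le_sum (f := fun i : ℕ => y ^ i / (i.factorial : ℝ))
      (fun i _ => by positivity) (Finset.mem_range.2 hN)
  linarith

lemma exists_logLatticeSum_le_rpow {τ : ℝ} (hτ : 0 < τ) :
    ∃ C : ℝ, 0 < C ∧ ∀ y : ℝ, 0 < y → logLatticeSum y ≤ C * y ^ (-τ) := by
  set N := ⌈τ⌉₊
  have hN : 0 < N := Nat.ceil_pos.2 hτ
  have hN' : (0 : ℝ) < N := by exact_mod_cast hN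
  set θ := τ / N with hθ
  have hθ0 : 0 < θ := by positivity
  have hθ1 : θ ≤ 1 := (div_le_one hN').2 (Nat.le_ceil τ)
  refine ⟨(2 * N.factorial) ^ θ / θ, by positivity, fun y hy => ?_⟩
  have hx := two_div_exp_sub_one_pos hy
  calc logLatticeSum y ≤ (2 / (Real.exp y - 1)) ^ θ / θ := log_one_add_le_rpow_div hx.le hθ0 hθ1
    _ ≤ (2 / (y ^ N / N.factorial)) ^ θ / θ := by
        gcongr
        exact pow_div_factorial_le_exp_sub_one hy.le hN
    _ = (2 * N.factorial) ^ θ / θ * y ^ (-τ) := by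
        have pow_rpow : (y ^ N) ^ θ = y ^ τ := by
          rw [← Real.rpow_natCast, ← Real.rpow_mul hy.le, hθ, mul_div_cancel₀ _ hN'.ne']
        have flip : 2 / (y ^ N / N.factorial) = 2 * N.factorial / y ^ N := by field_simp
        rw [flip, Real.div_rpow (by positivity) (by positivity), pow_rpow, Real.rpow_neg hy.le]
        ring

variable {ι : Type*} [Fintype ι] {a : ι → ℝ}

lemma finite_setOf_sum_mul_abs_le_one (ha : ∀ i, 0 < a i) :
    {k : ι → ℤ | ∑ i, a i * |(k i : ℝ)| ≤ 1}.Finite := by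
  refine (Set.Finite.pi fun i => Set.finite_Icc (-⌈1 / a i⌉) ⌈1 / a i⌉).subset
    fun k hk i _ => ?_
  have term_le : a i * |(k i : ℝ)| ≤ 1 := (Finset.single_le_sum
    (f := fun i => a i * |(k i : ℝ)|)
    (fun j _ => mul_nonneg (ha j).le (abs_nonneg _)) (Finset.mem_univ i)).trans hk
  have abs_le_ceil : ((|k i| : ℤ) : ℝ) ≤ (⌈1 / a i⌉ : ℤ) := by
    rw [Int.cast_abs]
    exact ((le_div_iff₀' (ha i)).2 term_le).trans (Int.le_ceil _)
  exact Set.mem_Icc.2 (abs_le.1 (by exact_mod_cast abs_le_ceil))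

/-- Chernoff's method: each point of the ball has weight at least `1`, and the total weight
factorizes over the coordinates. -/
lemma ncard_setOf_sum_mul_abs_le_one_le (ha : ∀ i, 0 < a i) {l : ℝ} (hl : 0 < l) :
    ({k : ι → ℤ | ∑ i, a i * |(k i : ℝ)| ≤ 1}.ncard : ℝ) ≤
      Real.exp (l + ∑ i, logLatticeSum (l * a i)) := by
  classical
  set T := (finite_setOf_sum_mul_abs_le_one ha).toFinset with hT
  set B : ι → Finset ℤ := fun i => T.image fun k => k i
  have subset_pi : T ⊆ Fintype.piFinset B := fun k hk =>
    Fintype.mem_piFinset.2 fun i => Finset.mem_image_of_mem _ hk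
  rw [Set.ncard_eq_toFinset_card _ (finite_setOf_sum_mul_abs_le_one ha), ← hT]
  have weight_ge_one : ∀ k ∈ T, 1 ≤ Real.exp l * ∏ i, Real.exp (-(l * a i * |(k i : ℝ)|)) := by
    intro k hk
    have hsum := mul_le_mul_of_nonneg_left
      ((Set.Finite.mem_toFinset (finite_setOf_sum_mul_abs_le_one ha)).1 hk) hl.le
    rw [← Real.exp_sum, ← Real.exp_add, Finset.sum_neg_distrib]
    simp only [mul_assoc, ← Finset.mul_sum]
    exact Real.one_le_exp (by linarith)
  calc (T.card : ℝ)
      = ∑ _ ∈ T, (1 : ℝ) := by simp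
    _ ≤ ∑ k ∈ T, Real.exp l * ∏ i, Real.exp (-(l * a i * |(k i : ℝ)|)) :=
        Finset.sum_le_sum weight_ge_one
    _ ≤ ∑ k ∈ Fintype.piFinset B, Real.exp l * ∏ i, Real.exp (-(l * a i * |(k i : ℝ)|)) :=
        Finset.sum_le_sum_of_subset_of_nonneg subset_pi fun _ _ _ => by positivity
    _ = Real.exp l * ∏ i, ∑ k ∈ B i, Real.exp (-(l * a i * |(k : ℝ)|)) := by
        rw [← Finset.mul_sum, Finset.prod_univ_sum]
    _ ≤ Real.exp l * ∏ i, Real.exp (logLatticeSum (l * a i)) := by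
        gcongr with i
        exact sum_le_hasSum _ (fun k _ => (Real.exp_pos _).le)
          (hasSum_exp_neg_mul_abs_int (mul_pos hl (ha i)))
    _ = Real.exp (l + ∑ i, logLatticeSum (l * a i)) := by rw [Real.exp_add, Real.exp_sum]

end LatticeCounting

section RiemannSums

lemma sum_range_rpow_neg_half_le (K : ℕ) :
    ∑ i ∈ Finset.range K, ((i : ℝ) + 1) ^ (-(1 / 2) : ℝ) ≤ 2 * Real.sqrt K := by
  induction K with
  | zero => simp
  | succ K ih =>
    have hK : (0 : ℝ) < (K : ℝ) + 1 := by positivity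
    have increment_le : ((K : ℝ) + 1) ^ (-(1 / 2) : ℝ) ≤
        2 * (Real.sqrt (K + 1) - Real.sqrt K) := by
      rw [Real.rpow_neg hK.le, ← Real.sqrt_eq_rpow, inv_eq_one_div,
        div_le_iff₀ (Real.sqrt_pos.2 hK)]
      nlinarith [sq_nonneg (Real.sqrt (K + 1) - Real.sqrt K), Real.sq_sqrt hK.le,
        Real.sq_sqrt (show (0 : ℝ) ≤ K by positivity)]
    rw [Finset.sum_range_succ]
    push_cast
    linarith

variable {C l : ℝ} {f : ℕ → ℝ}

lemma sum_range_le_of_le_rpow_neg_half (hC : 0 ≤ C) (hl : 0 < l)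
    (hf : ∀ i : ℕ, f i ≤ C * (((i : ℝ) + 1) / l) ^ (-(1 / 2) : ℝ)) {K : ℕ} (hK : (K : ℝ) ≤ l) :
    ∑ i ∈ Finset.range K, f i ≤ 2 * C * l :=
  calc ∑ i ∈ Finset.range K, f i
      ≤ ∑ i ∈ Finset.range K, C * Real.sqrt l * ((i : ℝ) + 1) ^ (-(1 / 2) : ℝ) := by
        refine Finset.sum_le_sum fun i _ => (hf i).trans (le_of_eq ?_)
        rw [Real.div_rpow (by positivity) hl.le, Real.rpow_neg hl.le, ← Real.sqrt_eq_rpow,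
          div_inv_eq_mul]
        ring
    _ ≤ C * Real.sqrt l * (2 * Real.sqrt l) := by
        rw [← Finset.mul_sum]
        gcongr
        exact (sum_range_rpow_neg_half_le K).trans (by gcongr)
    _ = 2 * C * l := by linear_combination 2 * C * Real.mul_self_sqrt hl.le

lemma sum_Ico_le_of_le_rpow_neg_two (hC : 0 ≤ C) (hl : 0 < l)
    (hf : ∀ i : ℕ, f i ≤ C * (((i : ℝ) + 1) / l) ^ (-2 : ℝ)) {K d : ℕ} (hK : 0 < K)
    (hKd : K ≤ d) : ∑ i ∈ Finset.Ico K d, f i ≤ C * l ^ 2 / K :=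
  calc ∑ i ∈ Finset.Ico K d, f i
      ≤ ∑ i ∈ Finset.Ico K d, C * l ^ 2 * (((i + 1 : ℕ) : ℝ) ^ 2)⁻¹ := by
        refine Finset.sum_le_sum fun i _ => (hf i).trans (le_of_eq ?_)
        rw [Real.rpow_neg (by positivity)]
        norm_cast
        rw [div_pow, inv_div]
        push_cast
        ring
    _ = C * l ^ 2 * ∑ i ∈ Finset.Ioc K d, ((i : ℝ) ^ 2)⁻¹ := by
        rw [← Finset.mul_sum, Finset.sum_Ico_add' (fun i : ℕ => ((i : ℝ) ^ 2)⁻¹) K d 1]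
        congr 2
        ext i
        simp only [Finset.mem_Ico, Finset.mem_Ioc]
        omega
    _ ≤ C * l ^ 2 * (1 / K) := by
        gcongr
        have : (0 : ℝ) ≤ (d : ℝ)⁻¹ := by positivity
        rw [one_div]
        linarith [sum_Ioc_inv_sq_le_sub (α := ℝ) hK.ne' hKd]
    _ = C * l ^ 2 / K := mul_one_div _ _

lemma sum_range_le_of_le_rpow (hC : 0 ≤ C) (hl : 1 ≤ l) (hf0 : ∀ i, 0 ≤ f i)
    (hf_half : ∀ i : ℕ, f i ≤ C * (((i : ℝ) + 1) / l) ^ (-(1 / 2) : ℝ))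
    (hf_two : ∀ i : ℕ, f i ≤ C * (((i : ℝ) + 1) / l) ^ (-2 : ℝ)) (d : ℕ) :
    ∑ i ∈ Finset.range d, f i ≤ 4 * C * l := by
  have hl0 : 0 < l := by linarith
  set K := ⌊l⌋₊
  have hK : 0 < K := Nat.floor_pos.2 hl
  have hK' : (1 : ℝ) ≤ K := by exact_mod_cast hK
  have l_le : l ≤ 2 * K := by linarith [Nat.lt_floor_add_one l]
  have head_le := sum_range_le_of_le_rpow_neg_half hC hl0 hf_half (Nat.floor_le hl0.le)
  have tail_le := sum_Ico_le_of_le_rpow_neg_two hC hl0 hf_two hK (le_max_left K d)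
  have tail_le_mul : C * l ^ 2 / K ≤ 2 * C * l := by
    rw [div_le_iff₀ (by linarith)]
    nlinarith [mul_nonneg hC hl0.le]
  calc ∑ i ∈ Finset.range d, f i ≤ ∑ i ∈ Finset.range (max K d), f i :=
        Finset.sum_le_sum_of_subset_of_nonneg (Finset.range_mono (le_max_right _ _))
          fun i _ _ => hf0 i
    _ = ∑ i ∈ Finset.range K, f i + ∑ i ∈ Finset.Ico K (max K d), f i :=
        (Finset.sum_range_add_sum_Ico _ (le_max_left _ _)).symm
    _ ≤ 4 * C * l := by linarith

end RiemannSums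

/-! ### The upper bound for `p < q` -/

section Truncation

lemma le_rpow_mul_rpow {z t w θ : ℝ} (hz : 0 ≤ z) (hzt : z ≤ t) (hzw : z ≤ w) (hθ0 : 0 ≤ θ)
    (hθ1 : θ ≤ 1) : z ≤ t ^ (1 - θ) * w ^ θ := by
  rcases hz.eq_or_lt with rfl | hz'
  · positivity
  · calc z = z ^ (1 - θ) * z ^ θ := by rw [← Real.rpow_add hz', sub_add_cancel, Real.rpow_one]
      _ ≤ t ^ (1 - θ) * w ^ θ :=
        mul_le_mul (Real.rpow_le_rpow hz hzt (by linarith)) (Real.rpow_le_rpow hz hzw hθ0)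
          (by positivity) (Real.rpow_nonneg (hz.trans hzt) _)

/-- Rounding towards `0`: the error is at most the step and at most `|y|`, hence at most any
geometric mean of the two. -/
lemma exists_int_abs_sub_mul_le_rpow {t θ : ℝ} (ht : 0 < t) (hθ0 : 0 ≤ θ) (hθ1 : θ ≤ 1) (y : ℝ) :
    ∃ k : ℤ, t * |(k : ℝ)| ≤ |y| ∧ |y - k * t| ≤ t ^ (1 - θ) * |y| ^ θ := by
  wlog hy : 0 ≤ y generalizing y
  · obtain ⟨k, hk, hky⟩ := this (-y) (by linarith)
    refine ⟨-k, by simpa using hk, ?_⟩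
    have neg_sub_eq : y - ((-k : ℤ) : ℝ) * t = -(-y - k * t) := by
      push_cast
      ring
    rwa [neg_sub_eq, abs_neg, ← abs_neg y]
  have floor_nonneg : (0 : ℝ) ≤ (⌊y / t⌋ : ℤ) := by
    exact_mod_cast Int.floor_nonneg.2 (by positivity)
  have floor_mul_le : ⌊y / t⌋ * t ≤ y := (le_div_iff₀ ht).1 (Int.floor_le _)
  have lt_floor_mul : y < (⌊y / t⌋ + 1) * t := (div_lt_iff₀ ht).1 (Int.lt_floor_add_one _)
  refine ⟨⌊y / t⌋, ?_, ?_⟩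
  · rwa [abs_of_nonneg floor_nonneg, abs_of_nonneg hy, mul_comm]
  · rw [abs_of_nonneg (sub_nonneg.2 floor_mul_le), abs_of_nonneg hy]
    exact le_rpow_mul_rpow (sub_nonneg.2 floor_mul_le) (by linarith)
      (by linarith [mul_nonneg floor_nonneg ht.le]) hθ0 hθ1

variable {p q : ℝ≥0∞}

lemma recip_mul_toReal_self (hp : 1 ≤ p) (htop : p ≠ ∞) : recip p * p.toReal = 1 := by
  rw [recip_eq_inv_toReal, inv_mul_cancel₀ (toReal_pos_of_one_le hp htop).ne']

lemma seqNorm_abs_rpow_le_one {ι : Type*} {f : ι → ℝ} (hp : 1 ≤ p) (hq : 1 ≤ q) (htop : p ≠ ∞)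
    (hf : seqNorm p f ≤ 1) : seqNorm q (fun n => |f n| ^ (recip q * p.toReal)) ≤ 1 := by
  rcases eq_or_ne q ∞ with rfl | hqtop
  · simp [seqNorm_top, recip]
  · have hq0 := toReal_pos_of_one_le hq hqtop
    rw [seqNorm_le_iff hp htop, ENNReal.one_rpow] at hf
    rw [seqNorm_le_iff hq hqtop, ENNReal.one_rpow]
    refine (tsum_congr fun n => ?_).trans_le hf
    rw [Real.enorm_rpow_of_nonneg (abs_nonneg _)
        (mul_nonneg (recip_nonneg q) ENNReal.toReal_nonneg), ← ENNReal.rpow_mul, mul_right_comm,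
      recip_mul_toReal_self hq hqtop, one_mul, Real.enorm_abs]

lemma sum_abs_rpow_le_one {ι : Type*} [Fintype ι] {f : ι → ℝ} (hp : 1 ≤ p) (htop : p ≠ ∞)
    (hf : seqNorm p f ≤ 1) : ∑ i, |f i| ^ p.toReal ≤ 1 := by
  rw [seqNorm_le_iff hp htop, ENNReal.one_rpow, tsum_fintype] at hf
  simp only [Real.enorm_eq_ofReal_abs, ENNReal.ofReal_rpow_of_nonneg (abs_nonneg _)
    ENNReal.toReal_nonneg] at hf
  rwa [← ENNReal.ofReal_sum_of_nonneg fun i _ => by positivity, ENNReal.ofReal_le_one] at hf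

/-- The weight `(ε / m) ^ (1 / (1/p - 1/q))` which a coordinate of semi-axis `m` carries in the
lattice point count at scale `ε`. -/
noncomputable def latticeWeight (p q : ℝ≥0∞) (ε m : ℝ) : ℝ :=
  (ε / m) ^ (1 / (recip p - recip q))

/-- The spacing of the lattice of centers in a coordinate of semi-axis `m`; it is balanced so that
rounding a point of the `p`-ellipsoid to the lattice changes it by at most `ε` in `ℓ^q`. -/
noncomputable def latticeStep (p q : ℝ≥0∞) (ε m : ℝ) : ℝ :=
  m * latticeWeight p q ε m ^ recip p

variable {ε m : ℝ}

lemma latticeWeight_pos (hε : 0 < ε) (hm : 0 < m) : 0 < latticeWeight p q ε m :=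
  Real.rpow_pos_of_pos (div_pos hε hm) _

lemma exists_int_lattice_approx (hp : 1 ≤ p) (hpq : p < q) (hε : 0 < ε) (hm : 0 < m) (y : ℝ) :
    ∃ k : ℤ, latticeWeight p q ε m * |(k : ℝ)| ≤ |y| ^ p.toReal ∧
      |m * y - k * latticeStep p q ε m| ≤ |ε * |y| ^ (recip q * p.toReal)| := by
  have hp0 := toReal_pos_of_one_le hp hpq.ne_top
  have hp1 : 1 ≤ p.toReal := ENNReal.toReal_mono hpq.ne_top hp
  have hpp := recip_mul_toReal_self hp hpq.ne_top
  have hlt := recip_lt_recip hp hpq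
  have hw := latticeWeight_pos (p := p) (q := q) hε hm
  have θ_le_one : recip q * p.toReal ≤ 1 :=
    hpp ▸ mul_le_mul_of_nonneg_right hlt.le hp0.le
  set t := latticeWeight p q ε m ^ recip p with ht
  have ht0 : 0 < t := by positivity
  have t_rpow : t ^ (1 - recip q * p.toReal) = ε / m := by
    have : recip p - recip q ≠ 0 := (sub_pos.2 hlt).ne'
    rw [ht, latticeWeight, ← Real.rpow_mul (by positivity), ← Real.rpow_mul (by positivity),
      show 1 / (recip p - recip q) * (recip p * (1 - recip q * p.toReal)) = 1 by
        field_simp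
        linear_combination -recip q * hpp, Real.rpow_one]
  have t_rpow_toReal : t ^ p.toReal = latticeWeight p q ε m := by
    rw [ht, ← Real.rpow_mul hw.le, hpp, Real.rpow_one]
  obtain ⟨k, hk, hky⟩ := exists_int_abs_sub_mul_le_rpow ht0
    (mul_nonneg (recip_nonneg q) hp0.le) θ_le_one y
  refine ⟨k, ?_, ?_⟩
  · have abs_le_rpow : |(k : ℝ)| ≤ |(k : ℝ)| ^ p.toReal := by
      rcases eq_or_ne k 0 with rfl | hk0
      · simp [hp0.ne']
      · exact Real.self_le_rpow_of_one_le (by exact_mod_cast Int.one_le_abs hk0) hp1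
    calc latticeWeight p q ε m * |(k : ℝ)| ≤ t ^ p.toReal * |(k : ℝ)| ^ p.toReal := by
          rw [t_rpow_toReal]
          gcongr
      _ = (t * |(k : ℝ)|) ^ p.toReal := (Real.mul_rpow ht0.le (abs_nonneg _)).symm
      _ ≤ |y| ^ p.toReal := by gcongr
  · calc |m * y - k * (m * t)| = m * |y - k * t| := by
          rw [← abs_of_pos hm, ← abs_mul, abs_of_pos hm]
          ring_nf
      _ ≤ m * (ε / m * |y| ^ (recip q * p.toReal)) := by
          rw [← t_rpow]
          gcongr
      _ = |ε * |y| ^ (recip q * p.toReal)| := by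
          rw [abs_of_nonneg (show 0 ≤ ε * |y| ^ (recip q * p.toReal) by positivity), ← mul_assoc,
            mul_div_cancel₀ _ hm.ne']

end Truncation

section LatticeCover

variable {p q : ℝ≥0∞} {μ : ℕ+ → ℝ} {ε : ℝ} {d : ℕ}

lemma exists_lattice_point_near (hp : 1 ≤ p) (hq : 1 ≤ q) (hpq : p < q) (hpos : ∀ n, 0 < μ n)
    (hε : 0 < ε) (hd : ∀ n, d ≤ n.natPred → μ n < ε) {x : ℕ+ → ℝ} (hx : x ∈ ellipsoid p μ) :
    ∃ k : Fin d → ℤ, ∑ i, latticeWeight p q ε (μ (firstIndices d i)) * |(k i : ℝ)| ≤ 1 ∧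
      seqNorm q (x - Function.extend (firstIndices d)
        (fun i => k i * latticeStep p q ε (μ (firstIndices d i))) 0) ≤ ENNReal.ofReal ε := by
  set f : ℕ+ → ℝ := fun n => x n / μ n
  have hf : seqNorm p f ≤ 1 := seqNorm_div_le_one hx
  have mul_f n : μ n * f n = x n := mul_div_cancel₀ _ (hpos n).ne'
  choose k hk happrox using fun n => exists_int_lattice_approx hp hpq hε (hpos n) (f n)
  have k_eq_zero n (hn : d ≤ n.natPred) : k n = 0 := by
    by_contra hne
    have one_le : (1 : ℝ) ≤ |(k n : ℝ)| := by exact_mod_cast Int.one_le_abs hne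
    have weight_gt : 1 < latticeWeight p q ε (μ n) :=
      Real.one_lt_rpow ((one_lt_div (hpos n)).2 (hd n hn))
        (one_div_pos.2 (sub_pos.2 (recip_lt_recip hp hpq)))
    have f_le_one : |f n| ^ p.toReal ≤ 1 := Real.rpow_le_one (abs_nonneg _)
      (ENNReal.ofReal_le_one.1 ((Real.enorm_eq_ofReal_abs (f n)).symm.trans_le
        ((enorm_le_seqNorm hp f n).trans hf))) ENNReal.toReal_nonneg
    nlinarith [hk n]
  refine ⟨fun i => k (firstIndices d i), ?_, ?_⟩
  · exact (Finset.sum_le_sum fun i _ => hk (firstIndices d i)).trans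
      (sum_abs_rpow_le_one hp hpq.ne_top ((seqNorm_comp_le (firstIndices_injective d) f).trans hf))
  · have center_eq n : Function.extend (firstIndices d)
        (fun i => k (firstIndices d i) * latticeStep p q ε (μ (firstIndices d i))) 0 n =
          k n * latticeStep p q ε (μ n) := by
      by_cases hn : ∃ i, firstIndices d i = n
      · obtain ⟨i, rfl⟩ := hn
        exact (firstIndices_injective d).extend_apply _ _ _
      · rw [Function.extend_apply' _ _ _ hn,
          k_eq_zero n (not_lt.1 (exists_firstIndices_eq_iff.not.1 hn))]
        simp
    calc seqNorm q (x - _) ≤ seqNorm q fun n => ε * |f n| ^ (recip q * p.toReal) :=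
          seqNorm_mono fun n => by simpa only [Pi.sub_apply, center_eq, mul_f] using happrox n
      _ ≤ ENNReal.ofReal ε * 1 := by
          rw [seqNorm_const_mul hq, Real.enorm_of_nonneg hε.le]
          gcongr
          exact seqNorm_abs_rpow_le_one hp hq hpq.ne_top hf
      _ = ENNReal.ofReal ε := mul_one _

lemma metricEntropy_le_sum_logLatticeSum [Fact (1 ≤ p)] [Fact (1 ≤ q)] (hpq : p < q)
    (hpos : ∀ n, 0 < μ n) (hε : 0 < ε) (hd : ∀ n, d ≤ n.natPred → μ n < ε) {l : ℝ} (hl : 0 < l) :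
    metricEntropy ε (ellipsoidIn p q μ) ≤
      (((l + ∑ i ∈ Finset.range d, logLatticeSum (l * latticeWeight p q ε (μ i.succPNat))) /
        Real.log 2 : ℝ) : EReal) := by
  set T : Set (Fin d → ℤ) :=
    {k | ∑ i, latticeWeight p q ε (μ (firstIndices d i)) * |(k i : ℝ)| ≤ 1}
  have weight_pos (i : Fin d) : 0 < latticeWeight p q ε (μ (firstIndices d i)) :=
    latticeWeight_pos hε (hpos _)
  have hT : T.Finite := finite_setOf_sum_mul_abs_le_one weight_pos
  let center (k : Fin d → ℤ) : lp (fun _ : ℕ+ => ℝ) q :=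
    ⟨_, memℓp_extend_firstIndices fun i => k i * latticeStep p q ε (μ (firstIndices d i))⟩
  have cover : Metric.IsCover ε.toNNReal (ellipsoidIn p q μ) (center '' T) := by
    intro x hx
    obtain ⟨k, hk, hxk⟩ := exists_lattice_point_near Fact.out Fact.out hpq hpos hε hd hx
    exact ⟨center k, Set.mem_image_of_mem _ hk, (edist_lp_eq_seqNorm _ _).trans_le hxk⟩
  have card_le : ((center '' T).ncard : ℝ) ≤ Real.exp (l + ∑ i ∈ Finset.range d,
      logLatticeSum (l * latticeWeight p q ε (μ i.succPNat))) := by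
    rw [Finset.sum_range]
    refine le_trans ?_ (ncard_setOf_sum_mul_abs_le_one_le weight_pos hl)
    exact Nat.cast_le.2 (Set.ncard_image_le hT)
  simpa only [Real.log_exp] using
    metricEntropy_le_of_isCover (Real.exp_pos _) cover (hT.image _) card_le

end LatticeCover

section LatticeAsymptotics

variable {p q : ℝ≥0∞} {b c : ℝ} {μ : ℕ+ → ℝ}

lemma exists_le_mul_rpow_neg
    (hμ : Tendsto (fun i : ℕ => μ i.succPNat * ((i : ℝ) + 1) ^ b) atTop (𝓝 c)) :
    ∃ M : ℝ, 0 < M ∧ ∀ i : ℕ, μ i.succPNat ≤ M * ((i : ℝ) + 1) ^ (-b) := by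
  obtain ⟨M, hM⟩ := hμ.bddAbove_range
  refine ⟨max M 1, by positivity, fun i => ?_⟩
  rw [Real.rpow_neg (by positivity), ← div_eq_mul_inv, le_div_iff₀ (by positivity)]
  exact (hM ⟨i, rfl⟩).trans (le_max_left _ _)

lemma exists_forall_natPred_ge_lt {M ε : ℝ} (hb : 0 < b) (hε : 0 < ε)
    (hμM : ∀ i : ℕ, μ i.succPNat ≤ M * ((i : ℝ) + 1) ^ (-b)) :
    ∃ d : ℕ, ∀ n, d ≤ n.natPred → μ n < ε := by
  have lim : Tendsto (fun i : ℕ => M * ((i : ℝ) + 1) ^ (-b)) atTop (𝓝 0) := by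
    simpa using ((tendsto_rpow_neg_atTop hb).comp
      (tendsto_atTop_add_const_right _ 1 tendsto_natCast_atTop_atTop)).const_mul M
  obtain ⟨d, hd⟩ := eventually_atTop.1 (lim.eventually (gt_mem_nhds hε))
  refine ⟨d, fun n hn => ?_⟩
  have := (hμM n.natPred).trans_lt (hd _ hn)
  rwa [PNat.succPNat_natPred] at this

/-- The choice `l = ε ^ (-1 / b*)` makes the weights scale-invariant. -/
lemma le_rpow_mul_latticeWeight (hp : 1 ≤ p) (hpq : p < q) (hb : 0 < b) {M m x ε : ℝ} (hM : 0 < M)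
    (hm : 0 < m) (hx : 0 < x) (hmM : m ≤ M * x ^ (-b)) (hε : 0 < ε) :
    (M ^ (1 / (recip p - recip q)))⁻¹ *
        (x / ε ^ (-(1 / bStar p q b))) ^ (b / (recip p - recip q)) ≤
      ε ^ (-(1 / bStar p q b)) * latticeWeight p q ε m := by
  have hΔ : 0 < recip p - recip q := sub_pos.2 (recip_lt_recip hp hpq)
  have hB : bStar p q b = b + (recip p - recip q) := by rw [bStar, add_sub_assoc]
  set Δ := recip p - recip q
  calc (M ^ (1 / Δ))⁻¹ * (x / ε ^ (-(1 / bStar p q b))) ^ (b / Δ)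
      = ε ^ (-(1 / bStar p q b)) * (ε / (M * x ^ (-b))) ^ (1 / Δ) := by
        have exponents : 1 / bStar p q b * (b / Δ) = -(1 / bStar p q b) + 1 / Δ := by
          rw [hB]
          field_simp
          ring
        rw [Real.rpow_neg hε.le, div_inv_eq_mul, Real.mul_rpow hx.le (by positivity),
          ← Real.rpow_mul hε.le, exponents, Real.rpow_add hε, Real.rpow_neg hε.le,
          Real.div_rpow hε.le (by positivity), Real.mul_rpow hM.le (by positivity),
          ← Real.rpow_mul hx.le, show -b * (1 / Δ) = -(b / Δ) by ring, Real.rpow_neg hx.le]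
        field_simp
    _ ≤ ε ^ (-(1 / bStar p q b)) * latticeWeight p q ε m := by
        unfold latticeWeight
        gcongr

lemma exists_logLatticeSum_le_of_scaling {κ a τ : ℝ} (hκ : 0 < κ) (ha : 0 < a) (hτ : 0 < τ) :
    ∃ C : ℝ, 0 < C ∧ ∀ x y : ℝ, 0 < x → κ * x ^ a ≤ y → logLatticeSum y ≤ C * x ^ (-τ) := by
  obtain ⟨C, hC, hCle⟩ := exists_logLatticeSum_le_rpow (div_pos hτ ha)
  refine ⟨C * κ ^ (-(τ / a)), by positivity, fun x y hx hy => ?_⟩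
  have hxa : 0 < κ * x ^ a := by positivity
  calc logLatticeSum y ≤ C * y ^ (-(τ / a)) := hCle y (hxa.trans_le hy)
    _ ≤ C * (κ * x ^ a) ^ (-(τ / a)) := mul_le_mul_of_nonneg_left
        (Real.rpow_le_rpow_of_nonpos hxa hy (neg_nonpos.2 (by positivity))) hC.le
    _ = C * κ ^ (-(τ / a)) * x ^ (-τ) := by
        rw [Real.mul_rpow hκ.le (by positivity), ← Real.rpow_mul hx.le,
          show a * -(τ / a) = -τ by field_simp, mul_assoc]

lemma exists_eventually_metricEntropy_le_rpow [Fact (1 ≤ p)] [Fact (1 ≤ q)] (hpq : p < q)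
    (hb : 0 < b) (hpos : ∀ n, 0 < μ n)
    (hμ : Tendsto (fun i : ℕ => μ i.succPNat * ((i : ℝ) + 1) ^ b) atTop (𝓝 c)) :
    ∃ C : ℝ, 0 < C ∧ ∀ᶠ ε in 𝓝[>] 0,
      metricEntropy ε (ellipsoidIn p q μ) ≤ ((C * ε ^ (-(1 / bStar p q b)) : ℝ) : EReal) := by
  obtain ⟨M, hM, hμM⟩ := exists_le_mul_rpow_neg hμ
  have hp : 1 ≤ p := Fact.out
  have hΔ : 0 < recip p - recip q := sub_pos.2 (recip_lt_recip hp hpq)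
  have hB := bStar_pos_of_lt hp hpq hb
  have := Real.log_pos one_lt_two
  have hκ : 0 < (M ^ (1 / (recip p - recip q)))⁻¹ := by positivity
  obtain ⟨C₁, hC₁, hle₁⟩ := exists_logLatticeSum_le_of_scaling hκ (div_pos hb hΔ) one_half_pos
  obtain ⟨C₂, -, hle₂⟩ := exists_logLatticeSum_le_of_scaling hκ (div_pos hb hΔ) two_pos
  have hC : 0 < max C₁ C₂ := lt_max_of_lt_left hC₁
  refine ⟨(1 + 4 * max C₁ C₂) / Real.log 2, by positivity, ?_⟩
  filter_upwards [Ioo_mem_nhdsGT one_pos] with ε ⟨hε, hε1⟩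
  set l := ε ^ (-(1 / bStar p q b))
  have hl0 : 0 < l := by positivity
  have hl1 : 1 ≤ l := Real.one_le_rpow_of_pos_of_le_one_of_nonpos hε hε1.le
    (neg_nonpos.2 (by positivity))
  obtain ⟨d, hd⟩ := exists_forall_natPred_ge_lt hb hε hμM
  have weight_ge (i : ℕ) := le_rpow_mul_latticeWeight hp hpq hb hM (hpos i.succPNat)
    (by positivity) (hμM i) hε
  refine (metricEntropy_le_sum_logLatticeSum hpq hpos hε hd hl0).trans (EReal.coe_le_coe_iff.2 ?_)
  have sum_le := sum_range_le_of_le_rpow hC.le hl1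
    (fun i => logLatticeSum_nonneg (mul_pos hl0 (latticeWeight_pos hε (hpos i.succPNat))))
    (fun i => (hle₁ _ _ (by positivity) (weight_ge i)).trans (by gcongr; exact le_max_left _ _))
    (fun i => (hle₂ _ _ (by positivity) (weight_ge i)).trans (by gcongr; exact le_max_right _ _)) d
  rw [div_mul_eq_mul_div]
  gcongr
  linarith

end LatticeAsymptotics

/-! ### Economical coverings by translates of a ball -/

section Greedy

variable {α : Type*} [MeasurableSpace α] {ν : Measure α} [SFinite ν] {E : Set (α × α)}
  {U Y : Set α} {π : ℝ≥0∞}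

lemma lintegral_measure_inter_swap (hE : MeasurableSet E) :
    ∫⁻ y in Y, ν (U ∩ {u | (y, u) ∈ E}) ∂ν = ∫⁻ u in U, ν (Y ∩ {y | (y, u) ∈ E}) ∂ν := by
  have left_eq y : ν (U ∩ {u | (y, u) ∈ E}) = ∫⁻ u in U, E.indicator 1 (y, u) ∂ν := by
    have section_meas : MeasurableSet {u | (y, u) ∈ E} := measurable_prodMk_left hE
    rw [Set.inter_comm, ← Measure.restrict_apply section_meas,
      ← lintegral_indicator_one section_meas]
    rfl
  have right_eq u : ν (Y ∩ {y | (y, u) ∈ E}) = ∫⁻ y in Y, E.indicator 1 (y, u) ∂ν := by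
    have section_meas : MeasurableSet {y | (y, u) ∈ E} := measurable_prodMk_right hE
    rw [Set.inter_comm, ← Measure.restrict_apply section_meas,
      ← lintegral_indicator_one section_meas]
    rfl
  simp only [left_eq, right_eq]
  exact lintegral_lintegral_swap (measurable_one.indicator hE).aemeasurable

/-- Averaging over the centers `y ∈ Y`. -/
lemma exists_mul_measure_le_measure_inter (hE : MeasurableSet E) (hU : MeasurableSet U)
    (hY : MeasurableSet Y) (hY0 : ν Y ≠ 0) (hYt : ν Y ≠ ∞) (hUt : ν U ≠ ∞)
    (hπ : ∀ u ∈ U, π * ν Y ≤ ν (Y ∩ {y | (y, u) ∈ E})) :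
    ∃ y ∈ Y, π * ν U ≤ ν (U ∩ {u | (y, u) ∈ E}) := by
  have le_integral : π * ν Y * ν U ≤ ∫⁻ y in Y, ν (U ∩ {u | (y, u) ∈ E}) ∂ν := by
    rw [lintegral_measure_inter_swap hE, ← setLIntegral_const]
    exact setLIntegral_mono' hU hπ
  have integral_ne_top : ∫⁻ y in Y, ν (U ∩ {u | (y, u) ∈ E}) ∂ν ≠ ∞ := by
    refine ((setLIntegral_mono' hY fun y _ => measure_mono Set.inter_subset_left).trans_lt
      (b := ∫⁻ _ in Y, ν U ∂ν) ?_).ne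
    rw [setLIntegral_const]
    exact ENNReal.mul_lt_top hUt.lt_top hYt.lt_top
  obtain ⟨y, hy, average_le⟩ := exists_setLAverage_le hY0 hY.nullMeasurableSet integral_ne_top
  refine ⟨y, hy, le_trans ?_ average_le⟩
  rwa [setLAverage_eq, ENNReal.le_div_iff_mul_le (Or.inl hY0) (Or.inl hYt), mul_right_comm]

lemma exists_finset_measure_diff_le (hE : MeasurableSet E) (hU : MeasurableSet U)
    (hY : MeasurableSet Y) (hY0 : ν Y ≠ 0) (hYt : ν Y ≠ ∞) (hUt : ν U ≠ ∞)
    (hπ : ∀ u ∈ U, π * ν Y ≤ ν (Y ∩ {y | (y, u) ∈ E})) (n : ℕ) :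
    ∃ S : Finset α, S.card ≤ n ∧
      ν (U \ ⋃ y ∈ S, {u | (y, u) ∈ E}) ≤ (1 - π) ^ n * ν U := by
  classical
  induction n with
  | zero => exact ⟨∅, le_rfl, by simp⟩
  | succ n ih =>
    obtain ⟨S, hS, hle⟩ := ih
    have rest_meas : MeasurableSet (U \ ⋃ y ∈ S, {u | (y, u) ∈ E}) :=
      hU.diff (S.measurableSet_biUnion fun y _ => measurable_prodMk_left hE)
    set rest := U \ ⋃ y ∈ S, {u | (y, u) ∈ E}
    have rest_ne_top : ν rest ≠ ∞ := ne_top_of_le_ne_top hUt (measure_mono Set.sdiff_subset)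
    obtain ⟨y, -, hy⟩ := exists_mul_measure_le_measure_inter hE rest_meas hY hY0 hYt rest_ne_top
      fun u hu => hπ u hu.1
    have diff_le : ν (rest \ {u | (y, u) ∈ E}) ≤ (1 - π) * ν rest := by
      rw [ENNReal.sub_mul fun _ _ => rest_ne_top, one_mul]
      refine ENNReal.le_sub_of_add_le_left (ne_top_of_le_ne_top rest_ne_top
        (hy.trans (measure_mono Set.inter_subset_left))) ((add_le_add_left hy _).trans ?_)
      exact (measure_inter_add_sdiff rest (measurable_prodMk_left hE)).le
    refine ⟨insert y S, (Finset.card_insert_le _ _).trans (by omega), ?_⟩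
    rw [Finset.set_biUnion_insert, Set.union_comm, ← Set.sdiff_sdiff, pow_succ', mul_assoc]
    exact diff_le.trans (by gcongr)

lemma one_sub_pow_floor_lt_inv {a Q : ℝ} (ha : 0 < a) (ha1 : a ≤ 1) (hQ : 0 < Q) :
    (1 - a) ^ (⌊Real.log Q / a⌋₊ + 1) < Q⁻¹ := by
  have log_lt := Nat.lt_floor_add_one (Real.log Q / a)
  rw [div_lt_iff₀ ha] at log_lt
  calc (1 - a) ^ (⌊Real.log Q / a⌋₊ + 1)
      ≤ Real.exp (-a) ^ (⌊Real.log Q / a⌋₊ + 1) :=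
        pow_le_pow_left₀ (by linarith) (by linarith [Real.add_one_le_exp (-a)]) _
    _ < Real.exp (-Real.log Q) := by
        rw [← Real.exp_nat_mul, Real.exp_lt_exp]
        push_cast
        linarith
    _ = Q⁻¹ := by rw [Real.exp_neg, Real.exp_log hQ]

lemma exists_finset_measure_diff_lt (hE : MeasurableSet E) (hU : MeasurableSet U)
    (hY : MeasurableSet Y) (hY0 : ν Y ≠ 0) (hYt : ν Y ≠ ∞) {a Q : ℝ} {m : ℝ≥0∞} (ha : 0 < a)
    (ha1 : a ≤ 1) (hQ : 1 ≤ Q) (hm0 : m ≠ 0) (hmt : m ≠ ∞) (hUm : ν U = ENNReal.ofReal Q * m)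
    (hπ : ∀ u ∈ U, ENNReal.ofReal a * ν Y ≤ ν (Y ∩ {y | (y, u) ∈ E})) :
    ∃ S : Finset α, (S.card : ℝ) ≤ Real.log Q / a + 1 ∧
      ν (U \ ⋃ y ∈ S, {u | (y, u) ∈ E}) < m := by
  have Q_pos : 0 < Q := one_pos.trans_le hQ
  obtain ⟨S, hS, hle⟩ := exists_finset_measure_diff_le hE hU hY hY0 hYt
    (hUm ▸ ENNReal.mul_ne_top ENNReal.ofReal_ne_top hmt) hπ (⌊Real.log Q / a⌋₊ + 1)
  refine ⟨S, ?_, hle.trans_lt ?_⟩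
  · calc (S.card : ℝ) ≤ ⌊Real.log Q / a⌋₊ + 1 := mod_cast hS
      _ ≤ Real.log Q / a + 1 := by
        gcongr
        exact Nat.floor_le (div_nonneg (Real.log_nonneg hQ) ha.le)
  · rw [hUm, ← mul_assoc, ← ENNReal.ofReal_one, ← ENNReal.ofReal_sub 1 ha.le,
      ← ENNReal.ofReal_pow (sub_nonneg.2 ha1), ← ENNReal.ofReal_mul (by bound)]
    conv_rhs => rw [← one_mul m]
    refine ENNReal.mul_lt_mul_left hm0 hmt (ENNReal.ofReal_lt_one.2 ?_)
    rw [← lt_div_iff₀ Q_pos, one_div]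
    exact one_sub_pow_floor_lt_inv ha ha1 Q_pos

end Greedy

section Rogers

open Metric Module

section Ball

variable {E : Type*} [NormedAddCommGroup E] [NormedSpace ℝ E] {T : E →ₗ[ℝ] E} {δ : ℝ}

lemma closedBall_subset_preimage_closedBall (hT1 : ∀ x, ‖T x‖ ≤ ‖x‖) {u : E} {r s : ℝ}
    (hu : ‖T u‖ ≤ r) : closedBall u s ⊆ T ⁻¹' closedBall 0 (r + s) := by
  intro y hy
  rw [mem_closedBall, dist_eq_norm] at hy
  rw [Set.mem_preimage, mem_closedBall_zero_iff]
  calc ‖T y‖ = ‖T u + T (y - u)‖ := by rw [← map_add, add_sub_cancel]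
    _ ≤ ‖T u‖ + ‖T (y - u)‖ := norm_add_le _ _
    _ ≤ r + s := add_le_add hu ((hT1 _).trans hy)

variable [FiniteDimensional ℝ E]

lemma measure_preimage_closedBall [MeasurableSpace E] [BorelSpace E] (ν : Measure E)
    [ν.IsAddHaarMeasure] (hT : LinearMap.det T ≠ 0) (u : E) {r s : ℝ} (hr : 0 < r) (hs : 0 ≤ s) :
    ν (T ⁻¹' closedBall 0 s) =
      ENNReal.ofReal ((s / r) ^ finrank ℝ E * |LinearMap.det T|⁻¹) * ν (closedBall u r) := by
  rw [Measure.addHaar_preimage_linearMap ν hT, Measure.addHaar_closedBall ν 0 hs,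
    Measure.addHaar_closedBall ν u hr.le, abs_inv, ← mul_assoc, ← mul_assoc,
    ← ENNReal.ofReal_mul (by positivity), ← ENNReal.ofReal_mul (by positivity), div_pow]
  congr 2
  field_simp

lemma one_le_div_pow_mul_inv_abs_det (hT : LinearMap.det T ≠ 0) (hT1 : ∀ x, ‖T x‖ ≤ ‖x‖)
    {r s : ℝ} (hr : 0 < r) (hrs : r ≤ s) : 1 ≤ (s / r) ^ finrank ℝ E * |LinearMap.det T|⁻¹ := by
  let _ : MeasurableSpace E := borel E
  have : BorelSpace E := ⟨rfl⟩
  have : ProperSpace E := FiniteDimensional.proper ℝ E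
  have ball_subset : closedBall (0 : E) r ⊆ T ⁻¹' closedBall 0 s :=
    (closedBall_subset_preimage_closedBall hT1 (by rw [map_zero, norm_zero])).trans
      (Set.preimage_mono (closedBall_subset_closedBall ((zero_add r).trans_le hrs)))
  have measure_le := measure_mono (μ := (Measure.addHaar : Measure E)) ball_subset
  rw [measure_preimage_closedBall _ hT 0 hr (hr.le.trans hrs)] at measure_le
  by_contra! hlt
  refine measure_le.not_gt ((ENNReal.mul_lt_mul_left (measure_closedBall_pos _ _ hr).ne'
    measure_closedBall_lt_top.ne (ENNReal.ofReal_lt_one.2 hlt)).trans_eq (one_mul _))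

/-- Greedily chosen balls of radius `1 - δ` leave less than a ball of radius `δ` uncovered. -/
lemma exists_finset_measure_preimage_diff_lt [MeasurableSpace E] [BorelSpace E] (ν : Measure E)
    [ν.IsAddHaarMeasure] (hT : LinearMap.det T ≠ 0)
    (hT1 : ∀ x, ‖T x‖ ≤ ‖x‖) (hδ0 : 0 < δ) (hδ1 : δ < 1) :
    ∃ S : Finset E, (S.card : ℝ) ≤ (2 / (1 - δ)) ^ finrank ℝ E * |LinearMap.det T|⁻¹ *
        Real.log (((1 + δ) / δ) ^ finrank ℝ E * |LinearMap.det T|⁻¹) + 1 ∧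
      ν (T ⁻¹' closedBall 0 (1 + δ) \ ⋃ y ∈ S, closedBall y (1 - δ)) <
        ν (closedBall 0 δ) := by
  have : ProperSpace E := FiniteDimensional.proper ℝ E
  have hρ : 0 < 1 - δ := sub_pos.2 hδ1
  have : 0 < |LinearMap.det T| := abs_pos.2 hT
  have one_le_ratio := one_le_div_pow_mul_inv_abs_det hT hT1 hρ (by linarith : 1 - δ ≤ 2)
  have preimage_meas (r : ℝ) : MeasurableSet (T ⁻¹' closedBall 0 r) :=
    (isClosed_closedBall.preimage T.continuous_of_finiteDimensional).measurableSet
  have measure_centers (u : E) := measure_preimage_closedBall ν hT u hρ zero_le_two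
  set ratio := (2 / (1 - δ)) ^ finrank ℝ E * |LinearMap.det T|⁻¹
  have proportion (u) (hu : u ∈ T ⁻¹' closedBall 0 (1 + δ)) :
      ENNReal.ofReal ratio⁻¹ * ν (T ⁻¹' closedBall 0 2) ≤
        ν (T ⁻¹' closedBall 0 2 ∩ {y | (y, u) ∈ {z : E × E | dist z.2 z.1 ≤ 1 - δ}}) := by
    have subset : closedBall u (1 - δ) ⊆ T ⁻¹' closedBall 0 2 := by
      have := closedBall_subset_preimage_closedBall hT1 (s := 1 - δ) (mem_closedBall_zero_iff.1 hu)
      rwa [show 1 + δ + (1 - δ) = 2 by ring] at this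
    rw [measure_centers u, ← mul_assoc, ← ENNReal.ofReal_mul (by positivity),
      inv_mul_cancel₀ (by positivity), ENNReal.ofReal_one, one_mul]
    exact measure_mono (Set.subset_inter subset fun y hy => (dist_comm u y).trans_le hy)
  obtain ⟨S, hS, hlt⟩ := exists_finset_measure_diff_lt (ν := ν)
    (isClosed_le (continuous_snd.dist continuous_fst) continuous_const).measurableSet
    (preimage_meas (1 + δ)) (preimage_meas 2) (measure_centers 0 ▸ mul_ne_zero
      (ENNReal.ofReal_pos.2 (by positivity)).ne' (measure_closedBall_pos ν 0 hρ).ne')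
    (measure_centers 0 ▸ ENNReal.mul_ne_top ENNReal.ofReal_ne_top measure_closedBall_lt_top.ne)
    (by positivity) (inv_le_one_of_one_le₀ one_le_ratio)
    (one_le_div_pow_mul_inv_abs_det hT hT1 hδ0 (by linarith))
    (measure_closedBall_pos ν 0 hδ0).ne' measure_closedBall_lt_top.ne
    (measure_preimage_closedBall ν hT 0 hδ0 (by linarith)) proportion
  exact ⟨S, by rwa [div_inv_eq_mul, mul_comm (Real.log _)] at hS, hlt⟩

lemma exists_finset_cover_preimage_closedBall (hT : LinearMap.det T ≠ 0)
    (hT1 : ∀ x, ‖T x‖ ≤ ‖x‖) (hδ0 : 0 < δ) (hδ1 : δ < 1) :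
    ∃ S : Finset E, (∀ x, ‖T x‖ ≤ 1 → ∃ y ∈ S, ‖x - y‖ ≤ 1) ∧
      (S.card : ℝ) ≤ (2 / (1 - δ)) ^ finrank ℝ E * |LinearMap.det T|⁻¹ *
        Real.log (((1 + δ) / δ) ^ finrank ℝ E * |LinearMap.det T|⁻¹) + 1 := by
  let _ : MeasurableSpace E := borel E
  have : BorelSpace E := ⟨rfl⟩
  obtain ⟨S, hcard, hS⟩ := exists_finset_measure_preimage_diff_lt Measure.addHaar hT hT1 hδ0 hδ1
  refine ⟨S, fun x hx => ?_, hcard⟩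
  by_contra! hfar
  refine hS.not_ge ?_
  rw [← Measure.addHaar_closedBall_center Measure.addHaar x δ]
  refine measure_mono fun u hu => ⟨closedBall_subset_preimage_closedBall hT1 hx hu, ?_⟩
  simp only [Set.mem_iUnion, mem_closedBall, not_exists, not_le] at hu ⊢
  intro y hy
  have hxy : 1 < dist x y := (hfar y hy).trans_eq (dist_eq_norm x y).symm
  linarith [dist_triangle_left x y u]

end Ball

variable {q : ℝ≥0∞} {ι : Type*} [Fintype ι]

lemma exists_finset_cover_scaled_ball (hq : 1 ≤ q) {w : ι → ℝ} (hw : ∀ i, 1 ≤ w i) {δ : ℝ}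
    (hδ0 : 0 < δ) (hδ1 : δ < 1) :
    ∃ S : Finset (ι → ℝ),
      (∀ x : ι → ℝ, seqNorm q (x / w) ≤ 1 → ∃ y ∈ S, seqNorm q (x - y) ≤ 1) ∧
      (S.card : ℝ) ≤ (2 / (1 - δ)) ^ Fintype.card ι * (∏ i, w i) *
        Real.log (((1 + δ) / δ) ^ Fintype.card ι * ∏ i, w i) + 1 := by
  classical
  have : Fact (1 ≤ q) := ⟨hq⟩
  have seqNorm_le_one_iff (x : ι → ℝ) : seqNorm q x ≤ 1 ↔ ‖WithLp.toLp q x‖ ≤ 1 := by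
    rw [seqNorm_eq_norm_toLp, ENNReal.ofReal_le_one]
  let e := (WithLp.linearEquiv q ℝ (ι → ℝ)).symm
  let T := e.toLinearMap ∘ₗ Matrix.toLin' (Matrix.diagonal w⁻¹) ∘ₗ e.symm.toLinearMap
  have T_apply (x : ι → ℝ) : T (WithLp.toLp q x) = WithLp.toLp q (x / w) := by
    ext i
    simp [T, e, Matrix.mulVec_diagonal, div_eq_inv_mul]
  have prod_pos : 0 < ∏ i, w i := Finset.prod_pos fun i _ => one_pos.trans_le (hw i)
  have det_eq : LinearMap.det T = (∏ i, w i)⁻¹ := by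
    rw [LinearMap.det_conj, LinearMap.det_toLin', Matrix.det_diagonal]
    exact Finset.prod_inv_distrib _
  have contraction (x) : ‖T x‖ ≤ ‖x‖ := by
    have := seqNorm_mono (q := q) (f := x.ofLp / w) (g := x.ofLp) fun i => by
      rw [Pi.div_apply, abs_div]
      exact div_le_self (abs_nonneg _) ((hw i).trans (le_abs_self _))
    rw [seqNorm_eq_norm_toLp, seqNorm_eq_norm_toLp] at this
    rw [← WithLp.toLp_ofLp q x, T_apply]
    exact (ENNReal.ofReal_le_ofReal_iff (norm_nonneg _)).1 this
  obtain ⟨S, hS, hcard⟩ := exists_finset_cover_preimage_closedBall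
    (det_eq ▸ (inv_pos.2 prod_pos).ne') contraction hδ0 hδ1
  rw [det_eq, abs_of_pos (inv_pos.2 prod_pos), inv_inv,
    finrank_eq_card_basis (PiLp.basisFun q ℝ ι)] at hcard
  refine ⟨S.image WithLp.ofLp, fun x hx => ?_, (Nat.cast_le.2 Finset.card_image_le).trans hcard⟩
  obtain ⟨y, hy, hxy⟩ := hS (WithLp.toLp q x) (by rwa [T_apply, ← seqNorm_le_one_iff])
  exact ⟨y.ofLp, Finset.mem_image_of_mem _ hy, (seqNorm_le_one_iff _).2 hxy⟩

end Rogers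

/-! ### From coverings of the head to coverings of the whole sequence -/

section HeadCover

open Function

variable {ι κ : Type*} {e : κ → ι} {q : ℝ≥0∞}

lemma seqNorm_extend_le_add (hq : 1 ≤ q) (he : Injective e) {y z : κ → ℝ} {η : ℝ≥0∞}
    (hyz : seqNorm q y ≤ seqNorm q z + η) (x : ι → ℝ) :
    seqNorm q (extend e y x) ≤ seqNorm q (extend e z x) + η := by
  rcases eq_or_ne q ∞ with rfl | htop
  · rw [seqNorm_top_extend he y, seqNorm_top_extend he z, ← max_add_add_right]
    exact max_le_max hyz le_self_add
  · have hq0 := toReal_pos_of_one_le hq htop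
    have minkowski := ENNReal.Lp_add_le Finset.univ ![seqNorm q z, seqNorm q (extend e 0 x)] ![η, 0]
      (ENNReal.toReal_mono htop hq)
    simp only [Fin.sum_univ_two, Matrix.cons_val_zero, Matrix.cons_val_one, add_zero,
      ENNReal.zero_rpow_of_pos hq0, one_div, ← seqNorm_extend_rpow_toReal hq htop he,
      ENNReal.rpow_rpow_inv hq0.ne'] at minkowski
    refine le_trans ?_ minkowski
    rw [ENNReal.le_rpow_inv_iff hq0, seqNorm_extend_rpow_toReal hq htop he]
    gcongr

lemma exists_level {k : ℕ} (hk : 0 < k) {a : ℝ} (ha0 : 0 ≤ a) (ha1 : a ≤ 1) :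
    ∃ j ≤ k, ∃ level : ℝ, level = ((j : ℝ) + 1) / k ∧ 0 < level ∧ a ≤ level ∧
      level ≤ a + 1 / k := by
  have hk0 : (0 : ℝ) < k := Nat.cast_pos.2 hk
  refine ⟨⌊a * k⌋₊, Nat.floor_le_of_le (mul_le_of_le_one_left hk0.le ha1), _, rfl,
    by positivity, (le_div_iff₀ hk0).2 (Nat.lt_floor_add_one _).le, ?_⟩
  rw [div_le_iff₀ hk0, add_mul, one_div_mul_cancel hk0.ne']
  gcongr
  exact Nat.floor_le (by positivity)

lemma seqNorm_inv_smul_le_one (hq : 1 ≤ q) {τ : ℝ} (hτ : 0 < τ) {f : ι → ℝ}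
    (hf : seqNorm q f ≤ ENNReal.ofReal τ) : seqNorm q (τ⁻¹ • f) ≤ 1 := by
  calc seqNorm q (τ⁻¹ • f) = ENNReal.ofReal τ⁻¹ * seqNorm q f := by
        rw [← Real.enorm_of_nonneg (inv_pos.2 hτ).le]
        exact seqNorm_const_mul hq _ _
    _ ≤ ENNReal.ofReal τ⁻¹ * ENNReal.ofReal τ := by gcongr
    _ = 1 := by
      rw [← ENNReal.ofReal_mul (inv_pos.2 hτ).le, inv_mul_cancel₀ hτ.ne', ENNReal.ofReal_one]

lemma sub_extend_zero (he : Injective e) (x : ι → ℝ) (y : κ → ℝ) :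
    x - extend e y 0 = extend e (x ∘ e - y) x := by
  funext n
  by_cases hn : ∃ i, e i = n
  · obtain ⟨i, rfl⟩ := hn
    simp [he.extend_apply]
  · simp [extend_apply' _ _ _ hn]

/-- The head is approximated after rounding its norm up to one of `k + 1` levels, so that the error
on the head exceeds its norm by at most `1 / k`. -/
lemma exists_seqNorm_sub_extend_le (hq : 1 ≤ q) (he : Injective e) {w : κ → ℝ}
    {S : Finset (κ → ℝ)}
    (hS : ∀ y : κ → ℝ, seqNorm q (y / w) ≤ 1 → ∃ z ∈ S, seqNorm q (y - z) ≤ 1) {k : ℕ} (hk : 0 < k)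
    {x : ι → ℝ} (hx : seqNorm q (extend e ((x ∘ e) / w) x) ≤ 1) :
    ∃ j ≤ k, ∃ z ∈ S,
      seqNorm q (x - extend e ((((j : ℝ) + 1) / k) • z) 0) ≤ 1 + ENNReal.ofReal (1 / k) := by
  have head_le_one : seqNorm q ((x ∘ e) / w) ≤ 1 := by
    have restrict := seqNorm_comp_le (q := q) he (extend e ((x ∘ e) / w) x)
    rw [extend_comp he] at restrict
    exact restrict.trans hx
  obtain ⟨a, ha⟩ : ∃ a : ℝ≥0, (a : ℝ≥0∞) = seqNorm q ((x ∘ e) / w) :=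
    ⟨_, ENNReal.coe_toNNReal (ne_top_of_le_ne_top ENNReal.one_ne_top head_le_one)⟩
  have a_le_one : (a : ℝ) ≤ 1 := by
    rw [← ha] at head_le_one
    exact_mod_cast head_le_one
  obtain ⟨j, hj, level, level_eq, level_pos, le_level, level_le⟩ :=
    exists_level hk a.coe_nonneg a_le_one
  obtain ⟨z, hz, hxz⟩ := hS (level⁻¹ • (x ∘ e)) (by
    rw [smul_div_assoc]
    refine seqNorm_inv_smul_le_one hq level_pos ?_
    rw [← ha, ← ENNReal.ofReal_coe_nnreal]
    exact ENNReal.ofReal_le_ofReal le_level)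
  have factor : x ∘ e - level • z = level • (level⁻¹ • (x ∘ e) - z) := by
    rw [smul_sub, smul_inv_smul₀ level_pos.ne']
  refine ⟨j, hj, z, hz, ?_⟩
  rw [← level_eq, sub_extend_zero he]
  refine (seqNorm_extend_le_add hq he ?_ x).trans (add_le_add_left hx _)
  rw [factor, ← ha, ← ENNReal.ofReal_coe_nnreal, ← ENNReal.ofReal_add a.coe_nonneg (by positivity)]
  calc seqNorm q (level • (level⁻¹ • (x ∘ e) - z))
      = ENNReal.ofReal level * seqNorm q (level⁻¹ • (x ∘ e) - z) := by
        rw [← Real.enorm_of_nonneg level_pos.le]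
        exact seqNorm_const_mul hq _ _
    _ ≤ ENNReal.ofReal level := mul_le_of_le_one_right' hxz
    _ ≤ ENNReal.ofReal (a + 1 / k) := ENNReal.ofReal_le_ofReal level_le

end HeadCover

section HeadEntropy

open Function

variable {q : ℝ≥0∞} [Fact (1 ≤ q)]

lemma metricEntropy_le_of_head_cover {d : ℕ} {w : Fin d → ℝ} {S : Finset (Fin d → ℝ)}
    (hS : ∀ y : Fin d → ℝ, seqNorm q (y / w) ≤ 1 → ∃ z ∈ S, seqNorm q (y - z) ≤ 1)
    {A : Set (lp (fun _ : ℕ+ => ℝ) q)} {τ : ℝ} (hτ : 0 < τ)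
    (hA : ∀ x ∈ A, seqNorm q (extend (firstIndices d) (((x : ℕ+ → ℝ) ∘ firstIndices d) / w)
      (x : ℕ+ → ℝ)) ≤ ENNReal.ofReal τ)
    {k : ℕ} (hk : 0 < k) {N : ℝ} (hN0 : 0 < N) (hN : (k + 1) * (S.card : ℝ) ≤ N) :
    metricEntropy (τ * (1 + 1 / k)) A ≤ ((Real.log N / Real.log 2 : ℝ) : EReal) := by
  have hq : 1 ≤ q := Fact.out
  let center : ℕ × (Fin d → ℝ) → lp (fun _ : ℕ+ => ℝ) q := fun z =>
    τ • ⟨extend (firstIndices d) ((((z.1 : ℝ) + 1) / k) • z.2) 0, memℓp_extend_firstIndices _⟩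
  refine metricEntropy_le_of_isCover (C := center '' (Finset.range (k + 1) ×ˢ S : Finset _)) hN0
    (fun x hx => ?_) ((Finset.finite_toSet _).image center) ?_
  · have normalized : seqNorm q (extend (firstIndices d)
        (((τ⁻¹ • (x : ℕ+ → ℝ)) ∘ firstIndices d) / w) (τ⁻¹ • (x : ℕ+ → ℝ))) ≤ 1 := by
      rw [Pi.smul_comp, smul_div_assoc, extend_smul]
      exact seqNorm_inv_smul_le_one hq hτ (hA x hx)
    obtain ⟨j, hj, z, hz, hle⟩ := exists_seqNorm_sub_extend_le hq (firstIndices_injective d) hS hk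
      normalized
    refine ⟨center (j, z), Set.mem_image_of_mem _ (Finset.mem_coe.2 (Finset.mk_mem_product
      (Finset.mem_range.2 (Nat.lt_succ_of_le hj)) hz)), ?_⟩
    change edist x _ ≤ ENNReal.ofReal (τ * (1 + 1 / k))
    rw [edist_lp_eq_seqNorm, ENNReal.ofReal_mul hτ.le,
      ENNReal.ofReal_add zero_le_one (by positivity), ENNReal.ofReal_one]
    have difference : (x : ℕ+ → ℝ) - center (j, z) = τ • (τ⁻¹ • (x : ℕ+ → ℝ) -
        extend (firstIndices d) ((((j : ℝ) + 1) / k) • z) 0) := by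
      rw [smul_sub, smul_inv_smul₀ hτ.ne']
      rfl
    rw [difference]
    refine (seqNorm_const_mul hq _ _).trans_le ?_
    rw [Real.enorm_of_nonneg hτ.le]
    gcongr
  · refine le_trans (Nat.cast_le.2 (Set.ncard_image_le (Finset.finite_toSet _)))
      (le_of_eq_of_le ?_ hN)
    rw [Set.ncard_coe_finset, Finset.card_product, Finset.card_range]
    push_cast
    rfl

end HeadEntropy

/-! ### Capped semi-axes -/

section Capped

open Function

variable {p q r : ℝ≥0∞} {μ : ℕ+ → ℝ}

lemma seqNorm_extend_div_le (hp : 1 ≤ p) (hq : 1 ≤ q) (hr : 1 ≤ r) (hpqr : p⁻¹ + r⁻¹ = q⁻¹)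
    (hpos : ∀ n, 0 < μ n) {κ : Type*} {e : κ → ℕ+} (he : Injective e) (m : ℝ) {x : ℕ+ → ℝ}
    (hx : x ∈ ellipsoid p μ) :
    seqNorm q (extend e ((x ∘ e) / fun i => μ (e i) / m) x) ≤
      seqNorm r (extend e (fun _ => m) μ) := by
  have product : extend e ((x ∘ e) / fun i => μ (e i) / m) x =
      fun n => x n / μ n * extend e (fun _ => m) μ n := by
    funext n
    by_cases hn : ∃ i, e i = n
    · obtain ⟨i, rfl⟩ := hn
      simp only [he.extend_apply, Pi.div_apply, comp_apply, div_div_eq_mul_div, div_mul_eq_mul_div]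
    · simp only [extend_apply' _ _ _ hn, div_mul_cancel₀ _ (hpos n).ne']
  rw [product]
  exact (seqNorm_mul_le hp hq hr hpqr _ _).trans (mul_le_of_le_one_left' (seqNorm_div_le_one hx))

lemma extend_firstIndices_const (μ : ℕ+ → ℝ) (d : ℕ) :
    extend (firstIndices d) (fun _ => μ d.succPNat) μ = fun n => μ (max n d.succPNat) := by
  funext n
  by_cases hn : ∃ i, firstIndices d i = n
  · obtain ⟨i, rfl⟩ := hn
    have index_le : firstIndices d i ≤ d.succPNat := Nat.succPNat_mono i.2.le
    rw [(firstIndices_injective d).extend_apply, max_eq_right index_le]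
  · rw [extend_apply' _ _ _ hn, max_eq_left]
    rw [exists_firstIndices_eq_iff, not_lt] at hn
    rw [← PNat.succPNat_natPred n]
    exact Nat.succPNat_mono hn

lemma seqNorm_comp_max_rpow_toReal (hr1 : 1 ≤ r) (hr : r ≠ ∞) (μ : ℕ+ → ℝ) (d : ℕ) :
    seqNorm r (fun n => μ (max n d.succPNat)) ^ r.toReal =
      d * ‖μ d.succPNat‖ₑ ^ r.toReal + ∑' i : ℕ, ‖μ (i + d).succPNat‖ₑ ^ r.toReal := by
  rw [seqNorm_rpow_toReal hr1 hr, ← Equiv.pnatEquivNat.symm.tsum_eq,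
    ← ENNReal.summable.sum_add_tsum_nat_add' (k := d)]
  simp only [Equiv.pnatEquivNat_symm_apply, ← Nat.succPNat_mono.map_max]
  congr 1
  · rw [Finset.sum_congr rfl fun i hi => by rw [max_eq_right (Finset.mem_range.1 hi).le],
      Finset.sum_const, Finset.card_range, nsmul_eq_mul]
  · simp only [le_add_iff_nonneg_left, zero_le, sup_of_le_left]

lemma sum_rpow_neg_le {s : ℝ} (hs : 1 < s) {a : ℝ} (ha : 0 < a) (N : ℕ) :
    ∑ i ∈ Finset.range N, (a + (i + 1 : ℕ)) ^ (-s) ≤ a ^ (1 - s) / (s - 1) := by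
  have antitone : AntitoneOn (fun x : ℝ => x ^ (-s)) (Set.Icc a (a + N)) :=
    fun x hx y _ hxy => Real.rpow_le_rpow_of_nonpos (ha.trans_le hx.1) hxy (by linarith)
  refine antitone.sum_le_integral.trans ?_
  rw [integral_rpow (Or.inr ⟨by linarith, fun h => ?_⟩), ← neg_div_neg_eq, neg_sub,
    show -s + 1 = 1 - s by ring, neg_sub]
  · have : 0 < s - 1 := by linarith
    gcongr
    exact sub_le_self _ (by positivity)
  · rw [Set.uIcc_of_le (le_add_of_nonneg_right N.cast_nonneg)] at h
    exact absurd h.1 (not_le.2 ha)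

lemma tsum_enorm_rpow_le (hpos : ∀ n, 0 < μ n) {R b A : ℝ} (hR : 0 < R) (hbR : 1 < b * R)
    (hA : 0 < A) {d : ℕ} (hd : 0 < d)
    (hμA : ∀ i : ℕ, μ (i + d).succPNat ≤ A * ((d : ℝ) + (i + 1 : ℕ)) ^ (-b)) :
    ∑' i : ℕ, ‖μ (i + d).succPNat‖ₑ ^ R ≤
      ENNReal.ofReal (A ^ R * ((d : ℝ) ^ (1 - b * R) / (b * R - 1))) := by
  refine ENNReal.tsum_le_of_sum_range_le fun N => ?_
  calc ∑ i ∈ Finset.range N, ‖μ (i + d).succPNat‖ₑ ^ R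
      ≤ ∑ i ∈ Finset.range N, ENNReal.ofReal (A ^ R * ((d : ℝ) + (i + 1 : ℕ)) ^ (-(b * R))) := by
        refine Finset.sum_le_sum fun i _ => ?_
        rw [Real.enorm_of_nonneg (hpos _).le, ENNReal.ofReal_rpow_of_nonneg (hpos _).le hR.le,
          ← neg_mul, Real.rpow_mul (by positivity), ← Real.mul_rpow hA.le (by positivity)]
        exact ENNReal.ofReal_le_ofReal (Real.rpow_le_rpow (hpos _).le (hμA i) hR.le)
    _ = ENNReal.ofReal (A ^ R * ∑ i ∈ Finset.range N, ((d : ℝ) + (i + 1 : ℕ)) ^ (-(b * R))) := by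
        rw [Finset.mul_sum, ENNReal.ofReal_sum_of_nonneg fun i _ => by positivity]
    _ ≤ _ := by
        gcongr
        exact sum_rpow_neg_le hbR (Nat.cast_pos.2 hd) N

lemma succPNat_le_mul_rpow {b A : ℝ} (hb : 0 ≤ b) (hA : 0 ≤ A) {d : ℕ} (hd : 0 < d)
    (hμA : ∀ i : ℕ, μ (i + d).succPNat ≤ A * ((d : ℝ) + (i + 1 : ℕ)) ^ (-b)) :
    μ d.succPNat ≤ A * (d : ℝ) ^ (-b) := by
  refine (zero_add d ▸ hμA 0).trans (mul_le_mul_of_nonneg_left ?_ hA)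
  exact Real.rpow_le_rpow_of_nonpos (Nat.cast_pos.2 hd) (by simp) (neg_nonpos.2 hb)

lemma natCast_mul_rpow_le (hpos : ∀ n, 0 < μ n) {R b A : ℝ} (hR : 0 ≤ R) (hb : 0 ≤ b)
    (hA : 0 ≤ A) {d : ℕ} (hd : 0 < d)
    (hμA : ∀ i : ℕ, μ (i + d).succPNat ≤ A * ((d : ℝ) + (i + 1 : ℕ)) ^ (-b)) :
    (d : ℝ) * μ d.succPNat ^ R ≤ A ^ R * (d : ℝ) ^ (1 - b * R) := by
  have hd0 : (0 : ℝ) < d := Nat.cast_pos.2 hd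
  have := (hpos d.succPNat).le
  calc (d : ℝ) * μ d.succPNat ^ R ≤ d * (A * (d : ℝ) ^ (-b)) ^ R := by
        gcongr
        exact succPNat_le_mul_rpow hb hA hd hμA
    _ = A ^ R * (d : ℝ) ^ (1 - b * R) := by
        rw [Real.mul_rpow hA (by positivity), ← Real.rpow_mul hd0.le, sub_eq_add_neg,
          Real.rpow_add hd0, Real.rpow_one, neg_mul]
        ring

lemma seqNorm_comp_max_le (hr1 : 1 ≤ r) (hr : r ≠ ∞) (hpos : ∀ n, 0 < μ n) {b A : ℝ}
    (hbr : 0 < b - recip r) (hA : 0 < A) {d : ℕ} (hd : 0 < d)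
    (hμA : ∀ i : ℕ, μ (i + d).succPNat ≤ A * ((d : ℝ) + (i + 1 : ℕ)) ^ (-b)) :
    seqNorm r (fun n => μ (max n d.succPNat)) ≤
      ENNReal.ofReal (A * (b / (b - recip r)) ^ recip r * (d : ℝ) ^ (-(b - recip r))) := by
  have hR := toReal_pos_of_one_le hr1 hr
  rw [recip_eq_inv_toReal] at hbr ⊢
  set R := r.toReal
  have hd0 : (0 : ℝ) < d := Nat.cast_pos.2 hd
  have hb : 0 < b := (inv_pos.2 hR).trans (sub_pos.1 hbr)
  have hbR : 0 < b * R - 1 := by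
    rw [sub_pos, ← inv_lt_iff_one_lt_mul₀ hR]
    exact sub_pos.1 hbr
  rw [← ENNReal.rpow_le_rpow_iff hR, seqNorm_comp_max_rpow_toReal hr1 hr,
    Real.enorm_of_nonneg (hpos _).le, ENNReal.ofReal_rpow_of_nonneg (hpos _).le hR.le,
    ← ENNReal.ofReal_natCast, ← ENNReal.ofReal_mul hd0.le,
    ENNReal.ofReal_rpow_of_nonneg (by positivity) hR.le]
  calc ENNReal.ofReal (d * μ d.succPNat ^ R) + ∑' i : ℕ, ‖μ (i + d).succPNat‖ₑ ^ R
      ≤ ENNReal.ofReal (A ^ R * (d : ℝ) ^ (1 - b * R)) +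
          ENNReal.ofReal (A ^ R * ((d : ℝ) ^ (1 - b * R) / (b * R - 1))) :=
        add_le_add (ENNReal.ofReal_le_ofReal (natCast_mul_rpow_le hpos hR.le hb.le hA.le hd hμA))
          (tsum_enorm_rpow_le hpos hR (by linarith) hA hd hμA)
    _ = _ := by
        rw [← ENNReal.ofReal_add (by positivity) (by positivity),
          Real.mul_rpow (by positivity) (by positivity), Real.mul_rpow hA.le (by positivity),
          ← Real.rpow_mul (by positivity), ← Real.rpow_mul hd0.le, inv_mul_cancel₀ hR.ne',
          Real.rpow_one, show -(b - R⁻¹) * R = 1 - b * R by field_simp; ring]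
        congr 1
        field_simp
        ring

lemma seqNorm_top_comp_max_le (hpos : ∀ n, 0 < μ n) (hanti : Antitone μ) (d : ℕ) :
    seqNorm ∞ (fun n => μ (max n d.succPNat)) ≤ ENNReal.ofReal (μ d.succPNat) := by
  rw [seqNorm_top]
  refine iSup_le fun n => ?_
  rw [Real.enorm_of_nonneg (hpos _).le]
  exact ENNReal.ofReal_le_ofReal (hanti (le_max_right _ _))

lemma gammaConst_pos {b : ℝ} (hb : 0 < b) (hB : 0 < bStar p q b) : 0 < gammaConst p q b :=
  Real.rpow_pos_of_pos (div_pos hb hB) _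

lemma eventually_seqNorm_comp_max_le (hr1 : 1 ≤ r) (hr : recip r = recip q - recip p) {b c : ℝ}
    (hc : 0 < c) (hpos : ∀ n, 0 < μ n) (hanti : Antitone μ)
    (hμ : Tendsto (fun i : ℕ => μ i.succPNat * ((i : ℝ) + 1) ^ b) atTop (𝓝 c))
    (hb : 0 < b) (hB : 0 < bStar p q b) {A : ℝ} (hA : c < A) :
    ∀ᶠ d : ℕ in atTop, seqNorm r (fun n => μ (max n d.succPNat)) ≤
      ENNReal.ofReal (A * gammaConst p q b * (d : ℝ) ^ (-bStar p q b)) := by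
  have hA0 : 0 < A := hc.trans hA
  have bStar_eq : bStar p q b = b - recip r := by rw [hr, bStar]; ring
  have gammaConst_eq : gammaConst p q b = (b / (b - recip r)) ^ recip r := by
    rw [gammaConst, ← bStar_eq, hr]
  filter_upwards [eventually_forall_ge_atTop.2 (hμ.eventually_le_const hA),
    eventually_gt_atTop 0] with d hd hd0
  have hμA : ∀ i : ℕ, μ (i + d).succPNat ≤ A * ((d : ℝ) + (i + 1 : ℕ)) ^ (-b) := fun i => by
    have h := hd (i + d) (Nat.le_add_left d i)
    rw [show ((i + d : ℕ) : ℝ) + 1 = (d : ℝ) + (i + 1 : ℕ) by push_cast; ring] at h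
    rwa [Real.rpow_neg (by positivity), ← div_eq_mul_inv, le_div_iff₀ (by positivity)]
  rw [gammaConst_eq, bStar_eq]
  rw [bStar_eq] at hB
  rcases eq_or_ne r ∞ with rfl | htop
  · refine (seqNorm_top_comp_max_le hpos hanti d).trans (ENNReal.ofReal_le_ofReal ?_)
    simp only [recip, ENNReal.inv_top, ENNReal.toReal_zero, Real.rpow_zero, mul_one, sub_zero]
    exact succPNat_le_mul_rpow hb.le hA0.le hd0 hμA
  · exact seqNorm_comp_max_le hr1 htop hpos hB hA0 hd0 hμA

end Capped

/-! ### The upper bound for `q ≤ p` -/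

section UpperBound

variable {p q r : ℝ≥0∞} {μ : ℕ+ → ℝ}

/-- Up to a factor independent of the sequence, the volume ratio of the ellipsoid with semi-axes
`μ 1, …, μ d` and the ball of radius `μ (d + 1)` in dimension `d`, on a logarithmic scale. -/
noncomputable def logVolumeRatio (μ : ℕ+ → ℝ) (d : ℕ) : ℝ :=
  ∑ i ∈ Finset.range d, Real.log (μ i.succPNat) - d * Real.log (μ d.succPNat)

lemma log_prod_div_eq_logVolumeRatio (hpos : ∀ n, 0 < μ n) (d : ℕ) :
    Real.log (∏ i, μ (firstIndices d i) / μ d.succPNat) = logVolumeRatio μ d := by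
  rw [Real.log_prod fun i _ => (div_pos (hpos _) (hpos _)).ne', logVolumeRatio, Finset.sum_range]
  simp only [Real.log_div (hpos _).ne' (hpos _).ne', Finset.sum_sub_distrib, Finset.sum_const,
    Finset.card_univ, Fintype.card_fin, nsmul_eq_mul]
  rfl

lemma one_le_div_of_antitone (hpos : ∀ n, 0 < μ n) (hanti : Antitone μ) {d : ℕ} (i : Fin d) :
    1 ≤ μ (firstIndices d i) / μ d.succPNat :=
  (one_le_div (hpos _)).2 (hanti (Nat.succPNat_mono i.2.le))

lemma metricEntropy_le_of_seqNorm_comp_max_le [Fact (1 ≤ p)] [Fact (1 ≤ q)] (hr : 1 ≤ r)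
    (hpqr : p⁻¹ + r⁻¹ = q⁻¹) (hpos : ∀ n, 0 < μ n) (hanti : Antitone μ) {d : ℕ} {τ : ℝ} (hτ : 0 < τ)
    (hcap : seqNorm r (fun n => μ (max n d.succPNat)) ≤ ENNReal.ofReal τ) {k : ℕ} (hk : 0 < k)
    {δ : ℝ} (hδ0 : 0 < δ) (hδ1 : δ < 1) :
    metricEntropy (τ * (1 + 1 / k)) (ellipsoidIn p q μ) ≤
      (((Real.log (k + 1) + (d * Real.log (2 / (1 - δ)) + logVolumeRatio μ d) +
        Real.log (d * Real.log ((1 + δ) / δ) + logVolumeRatio μ d + 1)) / Real.log 2 : ℝ) :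
        EReal) := by
  have hδ : 0 < 1 - δ := by linarith
  obtain ⟨S, hS, hcard⟩ :=
    exists_finset_cover_scaled_ball (q := q) Fact.out (one_le_div_of_antitone hpos hanti) hδ0 hδ1
  have one_le_ratio : 1 ≤ ∏ i, μ (firstIndices d i) / μ d.succPNat :=
    Finset.one_le_prod fun i _ => one_le_div_of_antitone hpos hanti i
  have log_ratio := log_prod_div_eq_logVolumeRatio hpos d
  generalize ∏ i, μ (firstIndices d i) / μ d.succPNat = W at one_le_ratio log_ratio hcard
  have hW : 0 < W := zero_lt_one.trans_le one_le_ratio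
  have one_le_pow (a : ℝ) (ha : 1 ≤ a) : 1 ≤ a ^ d * W :=
    one_le_mul_of_one_le_of_one_le (one_le_pow₀ ha) one_le_ratio
  have log_pow_mul (a : ℝ) (ha : 0 < a) :
      Real.log (a ^ d * W) = d * Real.log a + logVolumeRatio μ d := by
    rw [Real.log_mul (by positivity) hW.ne', Real.log_pow, log_ratio]
  have hX : 1 ≤ (2 / (1 - δ)) ^ d * W := one_le_pow _ ((one_le_div hδ).2 (by linarith))
  have hZ : 0 ≤ Real.log (((1 + δ) / δ) ^ d * W) :=
    Real.log_nonneg (one_le_pow _ ((one_le_div hδ0).2 (by linarith)))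
  rw [← log_pow_mul _ (by positivity), ← log_pow_mul _ (by positivity),
    ← Real.log_mul (by positivity) (by positivity), ← Real.log_mul (by positivity) (by positivity),
    mul_assoc]
  refine metricEntropy_le_of_head_cover hS hτ (fun x hx => ?_) hk (by positivity) ?_
  · refine (seqNorm_extend_div_le Fact.out Fact.out hr hpqr hpos (firstIndices_injective d) _
      hx).trans ?_
    rwa [extend_firstIndices_const]
  · gcongr
    rw [Fintype.card_fin] at hcard
    linarith

lemma tendsto_log_add_one_div {u : ℕ → ℝ} {l : ℝ} (hl : 0 < l)
    (hu : Tendsto (fun d => u d / d) atTop (𝓝 l)) :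
    Tendsto (fun d : ℕ => Real.log (u d + 1) / d) atTop (𝓝 0) := by
  have quotient : Tendsto (fun d : ℕ => (u d + 1) / d) atTop (𝓝 l) := by
    simpa only [add_div, add_zero] using hu.add tendsto_one_div_atTop_nhds_zero_nat
  have h := (tendsto_log_div_id.comp tendsto_natCast_atTop_atTop).add
    (((Real.continuousAt_log hl.ne').tendsto.comp quotient).div_atTop tendsto_natCast_atTop_atTop)
  rw [add_zero] at h
  refine h.congr' ?_
  filter_upwards [quotient.eventually (lt_mem_nhds hl), eventually_gt_atTop 0] with d hd hd0
  have hd0' : (d : ℝ) ≠ 0 := Nat.cast_ne_zero.2 hd0.ne'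
  simp only [Function.comp_apply]
  rw [← add_div, ← Real.log_mul hd0' hd.ne', mul_div_cancel₀ _ hd0']

lemma tendsto_entropy_bound_div {b : ℝ} (hb : 0 < b) {w : ℕ → ℝ}
    (hw : Tendsto (fun d => w d / d) atTop (𝓝 b)) (C₀ C₁ : ℝ) {C₂ : ℝ} (hC₂ : 0 < C₂) :
    Tendsto (fun d : ℕ => (C₀ + (d * C₁ + w d) + Real.log (d * C₂ + w d + 1)) / d) atTop
      (𝓝 (C₁ + b)) := by
  have affine (C : ℝ) : Tendsto (fun d : ℕ => (d * C + w d) / d) atTop (𝓝 (C + b)) := by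
    refine (hw.const_add C).congr' ?_
    filter_upwards [eventually_gt_atTop 0] with d hd
    have : (d : ℝ) ≠ 0 := Nat.cast_ne_zero.2 hd.ne'
    field_simp
  simpa only [add_div, zero_add, add_zero] using
    ((tendsto_const_div_atTop_nhds_zero_nat C₀).add (affine C₁)).add
      (tendsto_log_add_one_div (by positivity) (affine C₂))

lemma exists_log_two_div_one_sub_lt {η : ℝ} (hη : 0 < η) :
    ∃ δ : ℝ, 0 < δ ∧ δ < 1 ∧ Real.log (2 / (1 - δ)) < Real.log 2 + η := by
  refine ⟨1 - Real.exp (-(η / 2)), sub_pos.2 (Real.exp_lt_one_iff.2 (by linarith)),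
    sub_lt_self _ (Real.exp_pos _), ?_⟩
  rw [sub_sub_cancel, Real.log_div two_ne_zero (Real.exp_pos _).ne', Real.log_exp]
  linarith

lemma eventually_metricEntropy_rpow_le [Fact (1 ≤ p)] [Fact (1 ≤ q)] (hqp : q ≤ p) {b c : ℝ}
    (hb : 0 < b) (hc : 0 < c) (hpos : ∀ n, 0 < μ n) (hanti : Antitone μ)
    (hμ : Tendsto (fun i : ℕ => μ i.succPNat * ((i : ℝ) + 1) ^ b) atTop (𝓝 c))
    (hB : 0 < bStar p q b) {κ : ℝ} (hκ : 0 < κ) :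
    ∀ᶠ d : ℕ in atTop,
      metricEntropy ((1 + κ) * (gammaConst p q b * c) * (d : ℝ) ^ (-bStar p q b))
        (ellipsoidIn p q μ) ≤ (((b / Real.log 2 + 1 + κ) * d : ℝ) : EReal) := by
  obtain ⟨r, hr1, hpqr, hr⟩ := exists_holder_exponent (p := p) (q := q) Fact.out hqp
  have hγ := gammaConst_pos hb hB
  have hlog2 := Real.log_pos one_lt_two
  obtain ⟨δ, hδ0, hδ1, hδ⟩ := exists_log_two_div_one_sub_lt (mul_pos hκ hlog2)
  set σ := √(1 + κ)
  have hσ1 : 1 < σ := Real.lt_sqrt_of_sq_lt (by linarith)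
  obtain ⟨k, hk⟩ := exists_nat_one_div_lt (sub_pos.2 hσ1)
  have rate := tendsto_entropy_bound_div hb
    (tendsto_sum_log_sub_mul_log_div hc (fun i => hpos i.succPNat) hμ) (Real.log ((k + 1 : ℕ) + 1))
    (Real.log (2 / (1 - δ))) (C₂ := Real.log ((1 + δ) / δ))
    (Real.log_pos ((one_lt_div hδ0).2 (by linarith)))
  filter_upwards [eventually_seqNorm_comp_max_le hr1 hr hc hpos hanti hμ hb hB
      (lt_mul_of_one_lt_right hc hσ1),
    rate.eventually (gt_mem_nhds (add_lt_add_left hδ b)), eventually_gt_atTop 0]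
    with d hcap hrate hd
  have hd0 : (0 : ℝ) < d := Nat.cast_pos.2 hd
  refine (metricEntropy_antitone _ ?_).trans ((metricEntropy_le_of_seqNorm_comp_max_le hr1 hpqr hpos
    hanti (by positivity) hcap k.succ_pos hδ0 hδ1).trans (EReal.coe_le_coe_iff.2 ?_))
  · calc c * σ * gammaConst p q b * (d : ℝ) ^ (-bStar p q b) * (1 + 1 / (k + 1 : ℕ))
        ≤ c * σ * gammaConst p q b * (d : ℝ) ^ (-bStar p q b) * σ := by
          gcongr
          push_cast
          linarith
      _ = σ * σ * (gammaConst p q b * c) * (d : ℝ) ^ (-bStar p q b) := by ring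
      _ = _ := by rw [Real.mul_self_sqrt (by positivity)]
  · rw [div_lt_iff₀ hd0] at hrate
    rw [div_le_iff₀ hlog2]
    refine hrate.le.trans (le_of_eq ?_)
    field_simp
    ring

lemma memℓp_of_mem_ellipsoid [Fact (1 ≤ p)] [Fact (1 ≤ q)] (hqp : q ≤ p) {b c : ℝ} (hb : 0 < b)
    (hc : 0 < c) (hpos : ∀ n, 0 < μ n) (hanti : Antitone μ)
    (hμ : Tendsto (fun i : ℕ => μ i.succPNat * ((i : ℝ) + 1) ^ b) atTop (𝓝 c))
    (hB : 0 < bStar p q b) {x : ℕ+ → ℝ} (hx : x ∈ ellipsoid p μ) : Memℓp x q := by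
  have hq : 1 ≤ q := Fact.out
  obtain ⟨r, hr1, hpqr, hr⟩ := exists_holder_exponent (p := p) hq hqp
  obtain ⟨d, hd⟩ := (eventually_seqNorm_comp_max_le hr1 hr hc hpos hanti hμ hb hB
    (lt_two_mul_self hc)).exists
  have he := firstIndices_injective d
  have rescaled_le := seqNorm_extend_div_le Fact.out hq hr1 hpqr hpos he (μ d.succPNat) hx
  rw [extend_firstIndices_const] at rescaled_le
  have split : Function.extend (firstIndices d) (x ∘ firstIndices d) x = x := by
    funext n
    by_cases hn : ∃ i, firstIndices d i = n
    · obtain ⟨i, rfl⟩ := hn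
      rw [he.extend_apply, Function.comp_apply]
    · rw [Function.extend_apply' _ _ _ hn]
  rw [memℓp_iff_seqNorm_lt_top hq, ← split]
  refine (seqNorm_extend_le_add hq he le_add_self x).trans_lt (ENNReal.add_lt_top.2
    ⟨rescaled_le.trans_lt (hd.trans_lt ENNReal.ofReal_lt_top), ?_⟩)
  rw [seqNorm_eq_norm_toLp]
  exact ENNReal.ofReal_lt_top

end UpperBound

/-! ### Entropy asymptotics -/

section EntropyAsymptotics

variable {p q : ℝ≥0∞} [Fact (1 ≤ p)] [Fact (1 ≤ q)] {b c : ℝ} {μ : ℕ+ → ℝ}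

lemma not_isCompact_ellipsoidIn (hb : 0 < b) (hc : 0 < c) (hpos : ∀ n, 0 < μ n)
    (hμ : Tendsto (fun i : ℕ => μ i.succPNat * ((i : ℝ) + 1) ^ b) atTop (𝓝 c))
    (hB : bStar p q b ≤ 0) : ¬ IsCompact (ellipsoidIn p q μ) := fun hcompact =>
  have radius_pos : 0 < GammaConst p q * c := mul_pos (GammaConst_pos Fact.out Fact.out) hc
  metricEntropy_ne_top_of_isCompact (half_pos radius_pos) hcompact
    (metricEntropy_eq_top_of_bStar_nonpos hb hc hpos hμ hB (half_lt_self radius_pos))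

lemma exists_isLittleO_le_metricEntropy (hc : 0 < c) (hpos : ∀ n, 0 < μ n)
    (hμ : Tendsto (fun i : ℕ => μ i.succPNat * ((i : ℝ) + 1) ^ b) atTop (𝓝 c))
    (hB : 0 < bStar p q b) :
    ∃ r : ℝ → ℝ, (r =o[𝓝[>] 0] fun ε => ε ^ (-(1 / bStar p q b))) ∧ ∀ ε : ℝ, 0 < ε →
      ((b / Real.log 2 * (GammaConst p q * c / ε) ^ (1 / bStar p q b) + r ε : ℝ) : EReal) ≤
        metricEntropy ε (ellipsoidIn p q μ) :=
  exists_isLittleO_le_of_forall_nat (metricEntropy_antitone _)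
    (metricEntropy_nonneg (ellipsoidIn_nonempty p q μ))
    (mul_pos (GammaConst_pos Fact.out Fact.out) hc) hB
    fun _ hh => eventually_le_metricEntropy_rpow hc hpos hμ hh

lemma exists_metricEntropy_le_isLittleO (hqp : q ≤ p) (hb : 0 < b) (hc : 0 < c)
    (hpos : ∀ n, 0 < μ n) (hanti : Antitone μ)
    (hμ : Tendsto (fun i : ℕ => μ i.succPNat * ((i : ℝ) + 1) ^ b) atTop (𝓝 c))
    (hB : 0 < bStar p q b) :
    ∃ r : ℝ → ℝ, (r =o[𝓝[>] 0] fun ε => ε ^ (-(1 / bStar p q b))) ∧ ∀ ε : ℝ, 0 < ε →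
      metricEntropy ε (ellipsoidIn p q μ) ≤
        (((b / Real.log 2 + 1) * (gammaConst p q b * c / ε) ^ (1 / bStar p q b) + r ε : ℝ) :
          EReal) :=
  exists_le_isLittleO_of_forall_nat (metricEntropy_antitone _)
    (metricEntropy_nonneg (ellipsoidIn_nonempty p q μ)) (mul_pos (gammaConst_pos hb hB) hc) hB
    fun _ hκ => eventually_metricEntropy_rpow_le hqp hb hc hpos hanti hμ hB hκ

end EntropyAsymptotics

end EllipsoidEntropy

open EllipsoidEntropy in
theorem mainTheorem6 (p q : ℝ≥0∞) [Fact (1 ≤ p)] [Fact (1 ≤ q)] (b c : ℝ) (hb : 0 < b) (hc : 0 < c)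
    (μ : ℕ+ → ℝ) (hpos : ∀ n, 0 < μ n) (hanti : Antitone μ)
    (hμ : (fun n : ℕ+ => μ n - c / (n : ℝ) ^ b) =o[atTop] fun n : ℕ+ => 1 / (n : ℝ) ^ b) :
    -- (i)
    (q ≤ EllipsoidEntropy.threshold p b →
      ¬ IsCompact (EllipsoidEntropy.ellipsoidIn p q μ) ∧
      ∃ εstar : ℝ, 0 < εstar ∧ ∀ ε : ℝ, 0 < ε → ε < εstar →
        EllipsoidEntropy.metricEntropy ε (EllipsoidEntropy.ellipsoidIn p q μ) = ⊤) ∧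
    -- (ii)
    (EllipsoidEntropy.threshold p b < q → q ≤ p →
      (∀ x ∈ EllipsoidEntropy.ellipsoid p μ, Memℓp x q) ∧
      ∃ r₁ r₂ : ℝ → ℝ,
        (r₁ =o[𝓝[>] 0] fun ε => ε ^ (-(1 / EllipsoidEntropy.bStar p q b))) ∧
        (r₂ =o[𝓝[>] 0] fun ε => ε ^ (-(1 / EllipsoidEntropy.bStar p q b))) ∧
        ∀ ε : ℝ, 0 < ε →
          ((b / Real.log 2 * (EllipsoidEntropy.GammaConst p q * c / ε) ^
              (1 / EllipsoidEntropy.bStar p q b) + r₁ ε : ℝ) : EReal) ≤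
            EllipsoidEntropy.metricEntropy ε (EllipsoidEntropy.ellipsoidIn p q μ) ∧
          EllipsoidEntropy.metricEntropy ε (EllipsoidEntropy.ellipsoidIn p q μ) ≤
            (((b / Real.log 2 + 1) * (EllipsoidEntropy.gammaConst p q b * c / ε) ^
              (1 / EllipsoidEntropy.bStar p q b) + r₂ ε : ℝ) : EReal)) ∧
    -- (iii)
    (p < q →
      (∀ x ∈ EllipsoidEntropy.ellipsoid p μ, Memℓp x q) ∧
      (∃ r : ℝ → ℝ,
        (r =o[𝓝[>] 0] fun ε => ε ^ (-(1 / EllipsoidEntropy.bStar p q b))) ∧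
        ∀ ε : ℝ, 0 < ε →
          ((b / Real.log 2 * (EllipsoidEntropy.GammaConst p q * c / ε) ^
              (1 / EllipsoidEntropy.bStar p q b) + r ε : ℝ) : EReal) ≤
            EllipsoidEntropy.metricEntropy ε (EllipsoidEntropy.ellipsoidIn p q μ)) ∧
      (1 ≤ b → ∃ C : ℝ, 0 < C ∧ ∀ᶠ ε : ℝ in 𝓝[>] 0,
        EllipsoidEntropy.metricEntropy ε (EllipsoidEntropy.ellipsoidIn p q μ) ≤
          ((C * (ε ^ (-(1 / EllipsoidEntropy.bStar p q b)) *
            Real.logb 2 (Real.logb 2 ε⁻¹)) : ℝ) : EReal)) ∧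
      (b < 1 → ∃ C : ℝ, 0 < C ∧ ∀ᶠ ε : ℝ in 𝓝[>] 0,
        EllipsoidEntropy.metricEntropy ε (EllipsoidEntropy.ellipsoidIn p q μ) ≤
          ((C * (ε ^ (-(1 / EllipsoidEntropy.bStar p q b)) *
            (Real.logb 2 ε⁻¹) ^ (1 - b)) : ℝ) : EReal))) := by
  have hp : 1 ≤ p := Fact.out
  have hq : 1 ≤ q := Fact.out
  have semiaxes := tendsto_mul_rpow_of_isLittleO hμ
  refine ⟨fun hthr => ?_, fun hthr hqp => ?_, fun hpq => ?_⟩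
  · have hB := (le_threshold_iff_bStar_nonpos hp hq hb).1 hthr
    exact ⟨not_isCompact_ellipsoidIn hb hc hpos semiaxes hB, GammaConst p q * c,
      mul_pos (GammaConst_pos hp hq) hc,
      fun ε _ hε => metricEntropy_eq_top_of_bStar_nonpos hb hc hpos semiaxes hB hε⟩
  · have hB := lt_of_not_ge (hthr.not_ge ∘ (le_threshold_iff_bStar_nonpos hp hq hb).2)
    obtain ⟨r₁, hr₁, lower⟩ := exists_isLittleO_le_metricEntropy hc hpos semiaxes hB
    obtain ⟨r₂, hr₂, upper⟩ := exists_metricEntropy_le_isLittleO hqp hb hc hpos hanti semiaxes hB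
    exact ⟨fun x hx => memℓp_of_mem_ellipsoid hqp hb hc hpos hanti semiaxes hB hx,
      r₁, r₂, hr₁, hr₂, fun ε hε => ⟨lower ε hε, upper ε hε⟩⟩
  · have hB : 0 < bStar p q b := bStar_pos_of_lt hp hpq hb
    have upper := exists_eventually_metricEntropy_le_rpow hpq hb hpos semiaxes
    have rate_nonneg (ε : ℝ) (hε : 0 < ε) : 0 ≤ ε ^ (-(1 / bStar p q b)) := by positivity
    exact ⟨fun x hx => hx.1.of_exponent_ge hpq.le,
      exists_isLittleO_le_metricEntropy hc hpos semiaxes hB,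
      fun _ => eventually_le_mul_of_le rate_nonneg
        ((Real.tendsto_logb_atTop one_lt_two).comp tendsto_logb_inv) upper,
      fun hb1 => eventually_le_mul_of_le rate_nonneg
        ((tendsto_rpow_atTop (sub_pos.2 hb1)).comp tendsto_logb_inv) upper⟩
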